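/- Let $n\in\mathbb{N}$, let $D\subset\mathbb{C}^n$ be a (nonempty, open) bounded convex domain, and let $f\colon D\to D$ be a holomorphic map without fixed points in $D$. Notation. $k_D$ is the Kobayashi distance of $D$. For $x\in\partial D$, a complex supporting functional at $x$ is a $\mathbb{C}$-linear map $L\colon\mathbb{C}^n\to\mathbb{C}$ with $\mathrm{Re}\,L(z)<\mathrm{Re}\,L(x)$ for all $z\in D$; $\mathrm{Ch}(x)$ is the intersection of $\overline{D}$ with all the hyperplanes $x+\ker L$, where $L$ is a complex supporting functional at $x$; and $\mathrm{Ch}(F)=\bigcup_{x\in F}\mathrm{Ch}(x)$ for $F\subseteq\partial D$. The target set of $f$ is $T(f)=\bigcup_h h(D)$, where $h$ ranges over all holomorphic maps $h\colon D\to\mathbb{C}^n$ that are limits, uniformly on compact subsets of $D$, of a subsequence of the sequence of iterates $\{f^k\}$. A sequence $\mathbf{x}=\{x_\nu\}\subset D$ converging to $x\in\partial D$ is a horosphere sequence at $x$ if $\lim_{\nu\to\infty}[k_D(z,x_\nu)-k_D(z_0,x_\nu)]$ exists for all $z\in D$ (this does not depend on the point $z_0\in D$); in this case, for $z_0\in D$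 and $R>0$, put \[ G_{z_0}(x,R,\mathbf{x})=\Bigl\{z\in D\Bigm|\lim_{\nu\to\infty}\bigl[k_D(z,x_\nu)-k_D(z_0,x_\nu)\bigr]<\tfrac12\log R\Bigr\}. \] Theorem (Abate–Raissy). There exist $x\in\partial D$ and a horosphere sequence $\mathbf{x}$ at $x$ such that for every $z_0\in D$ we have \[ T(f)\subseteq\bigcap_{z\in D}\mathrm{Ch}\bigl(\overline{G_z(x,1,\mathbf{x})}\cap\partial D\bigr)=\bigcap_{R>0}\mathrm{Ch}\bigl(\overline{G_{z_0}(x,R,\mathbf{x})}\cap\partial D\bigr). \] In particular, the last intersection does not depend on $z_0$. -/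

import Mathlib

open Filter Topology Set
open scoped ENNReal

/-- `ℂⁿ` with its Euclidean norm. -/
abbrev Cn (n : ℕ) : Type := EuclideanSpace ℂ (Fin n)

/-- The Poincaré distance of the unit disk `Δ`:
`k_Δ(ζ, η) = (1/2) log ((1 + |t|) / (1 - |t|))`, `t = (ζ - η) / (1 - conj ζ * η)`. -/
noncomputable def poincareDist (ζ η : ℂ) : ℝ :=
  (1 / 2) * Real.log
    ((1 + ‖(ζ - η) / (1 - (starRingEnd ℂ) ζ * η)‖) /
      (1 - ‖(ζ - η) / (1 - (starRingEnd ℂ) ζ * η)‖))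

/-- The Lempert function `δ_D(z, w)`, with values in `[0, ∞]`: the infimum of `k_Δ(ζ₀, ζ₁)` over all
`ζ₀, ζ₁ ∈ Δ` for which some holomorphic `φ : Δ → D` has `φ ζ₀ = z` and `φ ζ₁ = w`
(`∞` if there are none). -/
noncomputable def lempertFun {n : ℕ} (D : Set (Cn n)) (z w : Cn n) : ℝ≥0∞ :=
  sInf {r : ℝ≥0∞ | ∃ (φ : ℂ → Cn n) (ζ₀ ζ₁ : ℂ),
    ζ₀ ∈ Metric.ball (0 : ℂ) 1 ∧ ζ₁ ∈ Metric.ball (0 : ℂ) 1 ∧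
    DifferentiableOn ℂ φ (Metric.ball (0 : ℂ) 1) ∧ MapsTo φ (Metric.ball (0 : ℂ) 1) D ∧
    φ ζ₀ = z ∧ φ ζ₁ = w ∧ r = ENNReal.ofReal (poincareDist ζ₀ ζ₁)}

/-- The Kobayashi pseudodistance with values in `[0, ∞]`: the infimum of
`∑_{j=1}^{k} δ_D(z_{j-1}, z_j)` over all finite chains `z = z_0, z_1, …, z_k = w` in `D`. -/
noncomputable def kobayashiEDist {n : ℕ} (D : Set (Cn n)) (z w : Cn n) : ℝ≥0∞ :=
  sInf {r : ℝ≥0∞ | ∃ (k : ℕ) (p : ℕ → Cn n), p 0 = z ∧ p k = w ∧ (∀ j ≤ k, p j ∈ D) ∧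
    r = ∑ j ∈ Finset.range k, lempertFun D (p j) (p (j + 1))}

/-- The Kobayashi (pseudo)distance `k_D(z, w)` as a real number; `kobayashiEDist D z w` is finite
for all points `z, w` of a (connected) domain `D`. -/
noncomputable def kobayashiDist {n : ℕ} (D : Set (Cn n)) (z w : Cn n) : ℝ :=
  (kobayashiEDist D z w).toReal

/-- `L` is a complex supporting functional of `D` at `x`. -/
def IsComplexSupportingFunctional {n : ℕ} (D : Set (Cn n)) (x : Cn n) (L : Cn n →ₗ[ℂ] ℂ) : Prop :=
  ∀ z ∈ D, (L z).re < (L x).re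

/-- `Ch(x)`: the intersection of the closure of `D` with all complex supporting hyperplanes
`x + ker L = {y | L y = L x}` at `x`. -/
def complexFace {n : ℕ} (D : Set (Cn n)) (x : Cn n) : Set (Cn n) :=
  {y | y ∈ closure D ∧
    ∀ L : Cn n →ₗ[ℂ] ℂ, IsComplexSupportingFunctional D x L → L y = L x}

/-- `Ch(F) = ⋃_{x ∈ F} Ch(x)`. -/
def complexFaces {n : ℕ} (D F : Set (Cn n)) : Set (Cn n) :=
  ⋃ x ∈ F, complexFace D x

/-- The target set `T(f) = ⋃_h h(D)`, where `h` runs over the holomorphic maps `h : D → ℂⁿ` that are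
limits, in the compact-open topology (locally uniformly on `D`), of a subsequence of the sequence of
iterates of `f`. -/
def targetSet {n : ℕ} (D : Set (Cn n)) (f : Cn n → Cn n) : Set (Cn n) :=
  {y | ∃ (h : Cn n → Cn n) (s : ℕ → ℕ), DifferentiableOn ℂ h D ∧ StrictMono s ∧
    TendstoLocallyUniformlyOn (fun ν => f^[s ν]) h atTop D ∧ y ∈ h '' D}

/-- `u` is a horosphere sequence at the boundary point `x` of `D`: a sequence in `D` converging to
`x` such that `k_D(z, u_ν) - k_D(z₀, u_ν)` has a finite limit for all `z ∈ D`. The notion does not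
depend on the base point `z₀ ∈ D`, so all base points are required. -/
def IsHorosphereSequence {n : ℕ} (D : Set (Cn n)) (x : Cn n) (u : ℕ → Cn n) : Prop :=
  x ∈ frontier D ∧ (∀ ν, u ν ∈ D) ∧ Tendsto u atTop (𝓝 x) ∧
    ∀ z₀ ∈ D, ∀ z ∈ D, ∃ l : ℝ,
      Tendsto (fun ν => kobayashiDist D z (u ν) - kobayashiDist D z₀ (u ν)) atTop (𝓝 l)

/-- The sequence horosphere `G_{z₀}(x, R, u)`: the points `z ∈ D` with
`lim_ν [k_D(z, u_ν) - k_D(z₀, u_ν)] < (1/2) log R`. The centre `x` is the limit of `u`, so it enters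
only through `u`. -/
def sequenceHorosphere {n : ℕ} (D : Set (Cn n)) (z₀ : Cn n) (R : ℝ) (u : ℕ → Cn n) :
    Set (Cn n) :=
  {z | z ∈ D ∧ ∃ l : ℝ,
    Tendsto (fun ν => kobayashiDist D z (u ν) - kobayashiDist D z₀ (u ν)) atTop (𝓝 l) ∧
      l < (1 / 2) * Real.log R}

/-! Fix a point z₁ of D. For 0 < s ≤ 1 the map (1 - s) f + s z₁ sends D into a relatively compact
homothetic copy of D and strictly decreases k_D between distinct points, so it has a fixed point. As
s → 0 these fixed points can accumulate only at ∂D, because an interior limit would be fixed by f. A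
subsequence u converges to a boundary point, and H(z) = lim [k_D(z, u_i) - k_D(z₁, u_i)] exists on
all of D. Since u_i is fixed by a k_D-nonexpansive perturbation of f, in the limit H ∘ f ≤ H
(`horofunction_map_le`). Moreover H is unbounded below (`exists_horofunction_le`).

The horosphere with pole z and radius R is the sublevel set {H < H(z) + ½ log R}. Moving the pole
and shrinking the radius both give arbitrarily low sublevel sets, hence the equality of the two
intersections. For the inclusion, let h be a limit of iterates. It maps D into ∂D
(`mem_frontier_of_tendsto_iterate`): an interior limit point has a bounded orbit by Całka's
argument, and a bounded orbit forces a fixed point. If H(p) < H(z), the orbit of p stays in the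
horosphere with pole z and radius 1, so h(p) lies in its closure; the maximum principle then places
h(D) in Ch(h(p)).

The metric geometry rests on one fact: on a convex domain, chains of discs can be replaced by one
disc with arbitrarily small loss (`glue_discs`, `HasDisc.trans_of_lt`). Taking convex combinations
of single discs then gives convexity of Kobayashi balls, and Harnack's inequality on single discs
gives their relative compactness. -/

/-- There is a holomorphic disc in `D` through `z` and `w` at hyperbolic distance `t`. -/
def HasDisc {n : ℕ} (D : Set (Cn n)) (t : ℝ) (z w : Cn n) : Prop :=
  ∃ φ : ℂ → Cn n, DifferentiableOn ℂ φ (Metric.ball 0 1) ∧ MapsTo φ (Metric.ball 0 1) D ∧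
    φ 0 = z ∧ φ (Real.tanh t : ℝ) = w

/-! ### Hyperbolic tangent, Poincaré distance and disc automorphisms -/

theorem tanh_lt_tanh_iff {a b : ℝ} : Real.tanh a < Real.tanh b ↔ a < b := by
  rw [← Real.artanh_lt_artanh_iff ⟨Real.neg_one_lt_tanh a, Real.tanh_lt_one a⟩
    ⟨Real.neg_one_lt_tanh b, Real.tanh_lt_one b⟩, Real.artanh_tanh, Real.artanh_tanh]

theorem tanh_pos {a : ℝ} (h : 0 < a) : 0 < Real.tanh a := by
  simpa using tanh_lt_tanh_iff.2 h

theorem tanh_nonneg {a : ℝ} (h : 0 ≤ a) : 0 ≤ Real.tanh a := by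
  rcases h.eq_or_lt with rfl | h
  · simp
  · exact (tanh_pos h).le

theorem tanh_abs (a : ℝ) : |Real.tanh a| = Real.tanh |a| := by
  rcases le_total 0 a with h | h
  · rw [abs_of_nonneg h, abs_of_nonneg (tanh_nonneg h)]
  · have := tanh_nonneg (neg_nonneg.2 h)
    rw [abs_of_nonpos h, Real.tanh_neg, abs_of_nonpos (by simpa using this)]

theorem exists_tanh_eq {r : ℝ} (h : -1 < r) (h' : r < 1) : ∃ t, Real.tanh t = r :=
  ⟨Real.artanh r, Real.tanh_artanh ⟨h, h'⟩⟩

theorem tanh_sub (a b : ℝ) :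
    Real.tanh (a - b) = (Real.tanh a - Real.tanh b) / (1 - Real.tanh a * Real.tanh b) := by
  have ha := (Real.cosh_pos a).ne'
  have hb := (Real.cosh_pos b).ne'
  have hc : Real.cosh a * Real.cosh b - Real.sinh a * Real.sinh b ≠ 0 := by
    rw [← Real.cosh_sub]; exact (Real.cosh_pos _).ne'
  simp only [Real.tanh_eq_sinh_div_cosh, Real.sinh_sub, Real.cosh_sub]
  have h2 : 1 - Real.sinh a / Real.cosh a * (Real.sinh b / Real.cosh b) ≠ 0 := by
    intro h
    apply hc
    field_simp at h
    linarith
  field_simp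

theorem tanh_mem_ball (t : ℝ) : ((Real.tanh t : ℝ) : ℂ) ∈ Metric.ball (0 : ℂ) 1 := by
  rw [mem_ball_zero_iff, Complex.norm_real]
  exact Real.abs_tanh_lt_one t

theorem half_log_tanh (t : ℝ) :
    (1 / 2) * Real.log ((1 + Real.tanh t) / (1 - Real.tanh t)) = t := by
  rw [← Real.artanh_eq_half_log ⟨(Real.neg_one_lt_tanh t).le, (Real.tanh_lt_one t).le⟩,
    Real.artanh_tanh]

theorem poincareDist_tanh (a b : ℝ) :
    poincareDist (Real.tanh a : ℝ) (Real.tanh b : ℝ) = |a - b| := by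
  have h : ‖(((Real.tanh a : ℝ) : ℂ) - (Real.tanh b : ℝ)) /
      (1 - (starRingEnd ℂ) (Real.tanh a : ℝ) * (Real.tanh b : ℝ))‖ = Real.tanh |a - b| := by
    rw [Complex.conj_ofReal, ← tanh_abs, tanh_sub, ← Real.norm_eq_abs, ← Complex.norm_real]
    push_cast
    rfl
  rw [poincareDist, h, half_log_tanh]

theorem one_add_conj_mul_ne_zero {a ζ : ℂ} (ha : ‖a‖ < 1) (hζ : ‖ζ‖ < 1) :
    1 + (starRingEnd ℂ) a * ζ ≠ 0 := by
  intro h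
  have h1 : ‖(starRingEnd ℂ) a * ζ‖ = 1 := by
    rw [show (starRingEnd ℂ) a * ζ = -1 by linear_combination h]; simp
  rw [norm_mul, Complex.norm_conj] at h1
  nlinarith [norm_nonneg a, norm_nonneg ζ]

theorem norm_mobius_lt_one {a ζ : ℂ} (ha : ‖a‖ < 1) (hζ : ‖ζ‖ < 1) :
    ‖(ζ + a) / (1 + (starRingEnd ℂ) a * ζ)‖ < 1 := by
  have h0 := norm_pos_iff.2 (one_add_conj_mul_ne_zero ha hζ)
  rw [norm_div, div_lt_one h0]
  have ha2 : ‖a‖ ^ 2 < 1 := by nlinarith [norm_nonneg a]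
  have hz2 : ‖ζ‖ ^ 2 < 1 := by nlinarith [norm_nonneg ζ]
  refine lt_of_pow_lt_pow_left₀ 2 h0.le ?_
  rw [← Complex.normSq_eq_norm_sq] at *
  rw [← Complex.normSq_eq_norm_sq] at *
  simp only [Complex.normSq_apply, Complex.add_re, Complex.add_im, Complex.mul_re, Complex.mul_im,
    Complex.conj_re, Complex.conj_im, Complex.one_re, Complex.one_im] at *
  nlinarith [mul_pos (sub_pos.2 ha2) (sub_pos.2 hz2)]

theorem norm_pseudohyperbolic (ζ₀ ζ₁ : ℂ) :
    ‖(ζ₀ - ζ₁) / (1 - (starRingEnd ℂ) ζ₀ * ζ₁)‖ =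
      ‖(ζ₁ + -ζ₀) / (1 + (starRingEnd ℂ) (-ζ₀) * ζ₁)‖ := by
  rw [← norm_neg]
  congr 1
  rw [← neg_div, map_neg]
  congr 1 <;> ring

theorem differentiableOn_mobius {a : ℂ} (ha : ‖a‖ < 1) :
    DifferentiableOn ℂ (fun ζ => (ζ + a) / (1 + (starRingEnd ℂ) a * ζ)) (Metric.ball 0 1) := by
  refine DifferentiableOn.div (by fun_prop) (by fun_prop) fun ζ hζ => ?_
  exact one_add_conj_mul_ne_zero ha (by simpa using hζ)

theorem mapsTo_mobius {a : ℂ} (ha : ‖a‖ < 1) :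
    MapsTo (fun ζ => (ζ + a) / (1 + (starRingEnd ℂ) a * ζ)) (Metric.ball 0 1) (Metric.ball 0 1) :=
  fun ζ hζ => by simpa using norm_mobius_lt_one ha (by simpa using hζ)

/-! ### Elementary operations on holomorphic discs -/

section
variable {n : ℕ} {D : Set (Cn n)} {z w y : Cn n} {s t : ℝ}

theorem HasDisc.of_points {φ : ℂ → Cn n} (hφ : DifferentiableOn ℂ φ (Metric.ball 0 1))
    (hm : MapsTo φ (Metric.ball 0 1) D) {ζ₀ ζ₁ : ℂ} (h₀ : ζ₀ ∈ Metric.ball (0 : ℂ) 1)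
    (h₁ : ζ₁ ∈ Metric.ball (0 : ℂ) 1) : HasDisc D (poincareDist ζ₀ ζ₁) (φ ζ₀) (φ ζ₁) := by
  have h₀' : ‖ζ₀‖ < 1 := by simpa using h₀
  have h₁' : ‖ζ₁‖ < 1 := by simpa using h₁
  have hn : ‖-ζ₀‖ < 1 := by simpa using h₀'
  set τ := (ζ₁ + -ζ₀) / (1 + (starRingEnd ℂ) (-ζ₀) * ζ₁) with hτ
  have hτ1 : ‖τ‖ < 1 := norm_mobius_lt_one hn h₁'
  have hr : ‖(ζ₀ - ζ₁) / (1 - (starRingEnd ℂ) ζ₀ * ζ₁)‖ = ‖τ‖ := norm_pseudohyperbolic ζ₀ ζ₁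
  obtain ⟨t, ht⟩ := exists_tanh_eq (r := ‖τ‖) (by linarith [norm_nonneg τ]) hτ1
  have hP : poincareDist ζ₀ ζ₁ = t := by
    rw [poincareDist, hr, ← ht, half_log_tanh]
  -- After a Möbius map moving ζ₀ to the origin, this rotation brings the second point onto the
  -- positive real axis.
  set e := Complex.exp (τ.arg * Complex.I) with he
  have hne : ‖e‖ = 1 := Complex.norm_exp_ofReal_mul_I _
  have hre : e * (‖τ‖ : ℝ) = τ := by rw [mul_comm]; exact Complex.norm_mul_exp_arg_mul_I τ
  have hrot : MapsTo (fun ζ : ℂ => e * ζ) (Metric.ball 0 1) (Metric.ball 0 1) := fun ζ hζ => by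
    simpa [hne] using hζ
  rw [hP]
  refine ⟨fun ζ => φ ((e * ζ + ζ₀) / (1 + (starRingEnd ℂ) ζ₀ * (e * ζ))), ?_, ?_, ?_, ?_⟩
  · exact hφ.comp ((differentiableOn_mobius h₀').comp (by fun_prop) hrot)
      ((mapsTo_mobius h₀').comp hrot)
  · exact hm.comp ((mapsTo_mobius h₀').comp hrot)
  · simp
  · simp only [ht, hre]
    congr 1
    have h2 := one_add_conj_mul_ne_zero hn h₁'
    have h3 := one_add_conj_mul_ne_zero h₀' hτ1
    have h4 : τ * (1 + (starRingEnd ℂ) (-ζ₀) * ζ₁) = ζ₁ + -ζ₀ := div_mul_cancel₀ _ h2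
    rw [map_neg] at h4
    rw [div_eq_iff h3]
    linear_combination h4

theorem HasDisc.of_tanh {φ : ℂ → Cn n} (hφ : DifferentiableOn ℂ φ (Metric.ball 0 1))
    (hm : MapsTo φ (Metric.ball 0 1) D) (a b : ℝ) :
    HasDisc D |a - b| (φ (Real.tanh a : ℝ)) (φ (Real.tanh b : ℝ)) := by
  rw [← poincareDist_tanh]
  exact HasDisc.of_points hφ hm (tanh_mem_ball a) (tanh_mem_ball b)

theorem HasDisc.symm (ht : 0 ≤ t) (h : HasDisc D t z w) : HasDisc D t w z := by
  obtain ⟨φ, h1, h2, rfl, rfl⟩ := h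
  have := HasDisc.of_tanh h1 h2 t 0
  simpa [abs_of_nonneg ht] using this

theorem HasDisc.left_mem (h : HasDisc D t z w) : z ∈ D := by
  obtain ⟨φ, h1, h2, rfl, rfl⟩ := h
  exact h2 (by simp)

theorem HasDisc.right_mem (h : HasDisc D t z w) : w ∈ D := by
  obtain ⟨φ, h1, h2, rfl, rfl⟩ := h
  exact h2 (tanh_mem_ball t)

theorem HasDisc.refl (hz : z ∈ D) (t : ℝ) : HasDisc D t z z :=
  ⟨fun _ => z, by fun_prop, fun _ _ => hz, rfl, rfl⟩

theorem HasDisc.comp {f : Cn n → Cn n} {D' : Set (Cn n)} (hf : DifferentiableOn ℂ f D)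
    (hm : MapsTo f D D') (h : HasDisc D t z w) : HasDisc D' t (f z) (f w) := by
  obtain ⟨φ, h1, h2, rfl, rfl⟩ := h
  exact ⟨f ∘ φ, hf.comp h1 h2, hm.comp h2, rfl, rfl⟩

/-- Discs through two points may be reparametrized by a contraction of the unit disc. -/
theorem HasDisc.of_scaled {φ : ℂ → Cn n} (hφ : DifferentiableOn ℂ φ (Metric.ball 0 1))
    (hm : MapsTo φ (Metric.ball 0 1) D) {r : ℝ} (hr : 0 ≤ r) (hrt : r ≤ Real.tanh t) :
    HasDisc D t (φ 0) (φ r) := by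
  rcases (hr.trans hrt).eq_or_lt with h0 | h0
  · have : r = 0 := by linarith
    subst this
    have := HasDisc.refl (t := t) (hm (show (0 : ℂ) ∈ Metric.ball (0 : ℂ) 1 by simp))
    simpa using this
  have hc : ‖((r / Real.tanh t : ℝ) : ℂ)‖ ≤ 1 := by
    rw [Complex.norm_real, Real.norm_of_nonneg (by positivity)]
    exact (div_le_one h0).2 hrt
  have hb : MapsTo (fun ζ : ℂ => ((r / Real.tanh t : ℝ) : ℂ) * ζ) (Metric.ball 0 1)
      (Metric.ball 0 1) := fun ζ hζ => by
    simp only [mem_ball_zero_iff, norm_mul] at hζ ⊢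
    nlinarith [norm_nonneg ζ]
  refine ⟨_, hφ.comp (by fun_prop) hb, hm.comp hb, by simp, ?_⟩
  simp only [Function.comp]
  rw [← Complex.ofReal_mul, div_mul_cancel₀ _ h0.ne']

theorem HasDisc.mono (hs : 0 ≤ s) (hst : s ≤ t) (h : HasDisc D s z w) : HasDisc D t z w := by
  obtain ⟨φ, h1, h2, rfl, rfl⟩ := h
  refine HasDisc.of_scaled h1 h2 (tanh_nonneg hs) ?_
  rcases hst.eq_or_lt with rfl | h
  · rfl
  · exact (tanh_lt_tanh_iff.2 h).le

theorem HasDisc.combo (hD : Convex ℝ D) {z' w' : Cn n} (h : HasDisc D t z w)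
    (h' : HasDisc D t z' w') {a b : ℝ} (ha : 0 ≤ a) (hb : 0 ≤ b) (hab : a + b = 1) :
    HasDisc D t (a • z + b • z') (a • w + b • w') := by
  obtain ⟨φ, h1, h2, rfl, rfl⟩ := h
  obtain ⟨ψ, h3, h4, rfl, rfl⟩ := h'
  exact ⟨fun ζ => a • φ ζ + b • ψ ζ, (h1.const_smul a).add (h3.const_smul b),
    fun ζ hζ => hD (h2 hζ) (h4 hζ) ha hb hab, rfl, rfl⟩

theorem HasDisc.of_ball {r : ℝ} (hr : Metric.ball z r ⊆ D) (hr0 : 0 < r) (ht : 0 < t)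
    (hw : ‖w - z‖ ≤ r * Real.tanh t) : HasDisc D t z w := by
  have h0 := tanh_pos ht
  refine ⟨fun ζ => z + (ζ / (Real.tanh t : ℝ)) • (w - z), by fun_prop, fun ζ hζ => hr ?_,
    by simp, ?_⟩
  · have hζ' : ‖ζ‖ < 1 := by simpa using hζ
    rw [mem_ball_iff_norm, add_sub_cancel_left, norm_smul, norm_div, Complex.norm_real,
      Real.norm_of_nonneg h0.le, div_mul_eq_mul_div, div_lt_iff₀ h0]
    calc ‖ζ‖ * ‖w - z‖ ≤ ‖ζ‖ * (r * Real.tanh t) := by gcongr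
      _ < 1 * (r * Real.tanh t) := by gcongr
      _ = _ := by ring
  · dsimp only
    rw [div_self (show ((Real.tanh t : ℝ) : ℂ) ≠ 0 by exact_mod_cast h0.ne'), one_smul,
      add_sub_cancel]

end

/-! ### Royden–Wong gluing and the Kobayashi distance as a one-disc distance -/

section
variable {n : ℕ} {D : Set (Cn n)} {z w y : Cn n} {s t : ℝ}

/-- Maximum principle: a holomorphic disc with boundary in an open convex set lies in that set. -/
theorem mem_of_sphere_mem (hc : Convex ℝ D) (ho : IsOpen D) {σ : ℂ → Cn n}
    (hσ : DifferentiableOn ℂ σ (Metric.closedBall 0 1))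
    (hm : ∀ ζ : ℂ, ‖ζ‖ = 1 → σ ζ ∈ D) {ζ : ℂ} (hζ : ‖ζ‖ < 1) : σ ζ ∈ D := by
  by_contra hn
  obtain ⟨L, hL⟩ := RCLike.geometric_hahn_banach_open_point (𝕜 := ℂ) hc ho hn
  have hcl : closure (Metric.ball (0 : ℂ) 1) = Metric.closedBall 0 1 :=
    closure_ball _ one_ne_zero
  -- Since |exp(L ∘ σ)| = exp(Re L ∘ σ), the maximum modulus principle bounds Re L ∘ σ by its value
  -- at a boundary point.
  have hd : DiffContOnCl ℂ (fun ζ => Complex.exp (L (σ ζ))) (Metric.ball 0 1) := by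
    apply DifferentiableOn.diffContOnCl
    rw [hcl]
    exact (L.differentiable.comp_differentiableOn hσ).cexp
  obtain ⟨η, hη, hmax⟩ := Complex.exists_mem_frontier_isMaxOn_norm Metric.isBounded_ball
    ⟨0, by simp⟩ hd
  rw [frontier_ball _ one_ne_zero, mem_sphere_zero_iff_norm] at hη
  have h1 := hmax (show ζ ∈ closure (Metric.ball (0 : ℂ) 1) by simp [hcl, hζ.le])
  have h2 := hL _ (hm η hη)
  simp only [Function.comp, mem_ofPred_eq, Complex.norm_exp, Real.exp_le_exp] at h1
  exact absurd h2 (not_lt.2 h1)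

/-- The rational function `(ζ - b)(ζ - 1/b) / ((ζ - a)(ζ - 1/a))` takes values in `[0, 1]` on the
unit circle. -/
theorem exists_royden_wong_weight {a b : ℝ} (ha : 0 < a) (hab : a < b) (hb : b < 1) {ζ : ℂ}
    (hζ : ‖ζ‖ = 1) : ∃ l : ℝ, 0 ≤ l ∧ l ≤ 1 ∧
      ((ζ - b) * (ζ - 1 / b)) / ((ζ - a) * (ζ - 1 / a)) = (l : ℂ) := by
  have hb0 : 0 < b := ha.trans hab
  have hz : ζ * (starRingEnd ℂ) ζ = 1 := by
    rw [Complex.mul_conj, Complex.normSq_eq_norm_sq, hζ]; simp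
  have hz0 : ζ ≠ 0 := by intro h; simp [h] at hζ
  -- On the circle the conjugate of ζ is 1/ζ. The non-real factor ζ cancels in the quotient, leaving
  -- (a/b) |ζ - b|² / |ζ - a|².
  have key : ∀ c : ℝ, 0 < c → (ζ - c) * (ζ - 1 / c) = -(ζ / c) * (Complex.normSq (ζ - c) : ℝ) := by
    intro c hc
    have hc' : (c : ℂ) ≠ 0 := by exact_mod_cast hc.ne'
    rw [← Complex.mul_conj, map_sub, Complex.conj_ofReal]
    field_simp
    linear_combination (ζ - c) * hz
  have hns : ∀ c : ℝ, Complex.normSq (ζ - c) = 1 + c ^ 2 - 2 * c * ζ.re := by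
    intro c
    have : ζ.re ^ 2 + ζ.im ^ 2 = 1 := by
      have := Complex.normSq_eq_norm_sq ζ
      rw [hζ, Complex.normSq_apply] at this
      linarith
    simp only [Complex.normSq_apply, Complex.sub_re, Complex.sub_im, Complex.ofReal_re,
      Complex.ofReal_im]
    linear_combination this
  have hre : ζ.re ≤ 1 := hζ ▸ Complex.re_le_norm ζ
  have hpos : 0 < Complex.normSq (ζ - a) := by
    rw [hns]; nlinarith [mul_pos (sub_pos.2 (hab.trans hb)) (sub_pos.2 (hab.trans hb))]
  refine ⟨a * Complex.normSq (ζ - b) / (b * Complex.normSq (ζ - a)), ?_, ?_, ?_⟩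
  · have := Complex.normSq_nonneg (ζ - b)
    positivity
  -- The terms in Re ζ cancel, and the claim becomes (b - a)(1 - ab) ≥ 0.
  · rw [div_le_one (by positivity), hns, hns]
    nlinarith [mul_pos (sub_pos.2 hab) (show 0 < 1 - a * b by nlinarith)]
  · rw [key a ha, key b hb0]
    have ha' : (a : ℂ) ≠ 0 := by exact_mod_cast ha.ne'
    have hb' : (b : ℂ) ≠ 0 := by exact_mod_cast hb0.ne'
    have hp' : ((Complex.normSq (ζ - a) : ℝ) : ℂ) ≠ 0 := by exact_mod_cast hpos.ne'
    push_cast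
    field_simp

/-- The Royden–Wong gluing of two discs that agree at a point. -/
theorem glue_discs (hc : Convex ℝ D) (ho : IsOpen D) {φ ψ : ℂ → Cn n} {ρ a b : ℝ} (hρ : 1 < ρ)
    (hφ : DifferentiableOn ℂ φ (Metric.ball 0 ρ)) (hψ : DifferentiableOn ℂ ψ (Metric.ball 0 ρ))
    (hφm : MapsTo φ (Metric.ball 0 ρ) D) (hψm : MapsTo ψ (Metric.ball 0 ρ) D)
    (ha : 0 < a) (hab : a < b) (hb : b < 1) (h : φ a = ψ a) :
    ∃ σ : ℂ → Cn n, DifferentiableOn ℂ σ (Metric.ball 0 1) ∧ MapsTo σ (Metric.ball 0 1) D ∧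
      σ 0 = φ 0 ∧ σ b = ψ b := by
  have ha1 : a < 1 := hab.trans hb
  have ha' : (a : ℂ) ≠ 0 := by exact_mod_cast ha.ne'
  have hb' : (b : ℂ) ≠ 0 := by exact_mod_cast (ha.trans hab).ne'
  have hamem : (a : ℂ) ∈ Metric.ball (0 : ℂ) ρ := by
    rw [mem_ball_zero_iff, Complex.norm_real, Real.norm_of_nonneg ha.le]; linarith
  set g := dslope (fun ζ => φ ζ - ψ ζ) (a : ℂ) with hg
  have hgd : DifferentiableOn ℂ g (Metric.ball 0 ρ) :=
    (Complex.differentiableOn_dslope (Metric.isOpen_ball.mem_nhds hamem)).2 (hφ.sub hψ)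
  have hgs : ∀ ζ : ℂ, (ζ - a) • g ζ = φ ζ - ψ ζ := by
    intro ζ
    rw [hg, sub_smul_dslope, h, sub_self, sub_zero]
  have hsub : Metric.closedBall (0 : ℂ) 1 ⊆ Metric.ball 0 ρ := Metric.closedBall_subset_ball hρ
  have hne : ∀ ζ : ℂ, ‖ζ‖ ≤ 1 → ζ - 1 / a ≠ 0 := by
    intro ζ hζ h0
    rw [sub_eq_zero.1 h0] at hζ
    rw [norm_div, norm_one, Complex.norm_real, Real.norm_of_nonneg ha.le, div_le_one ha] at hζ
    linarith
  -- This is λφ + (1 - λ)ψ with λ the rational weight; its pole at a is removed by φ(a) = ψ(a). On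
  -- the circle λ ∈ [0, 1], while λ(0) = 1 and λ(b) = 0.
  set σ : ℂ → Cn n := fun ζ => ψ ζ + ((ζ - b) * (ζ - 1 / b) / (ζ - 1 / a)) • g ζ with hσ
  have hσd : DifferentiableOn ℂ σ (Metric.closedBall 0 1) := by
    refine (hψ.mono hsub).add (DifferentiableOn.fun_smul ?_ (hgd.mono hsub))
    exact DifferentiableOn.div (by fun_prop) (by fun_prop) fun ζ hζ => hne ζ (by simpa using hζ)
  have hσm : ∀ ζ : ℂ, ‖ζ‖ = 1 → σ ζ ∈ D := by
    intro ζ hζ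
    have hmem : ζ ∈ Metric.ball (0 : ℂ) ρ := hsub (by simp [hζ])
    obtain ⟨l, hl0, hl1, hl⟩ := exists_royden_wong_weight ha hab hb hζ
    have hza : ζ - a ≠ 0 := by
      intro h0
      rw [sub_eq_zero.1 h0, Complex.norm_real, Real.norm_of_nonneg ha.le] at hζ
      linarith
    have : σ ζ = l • φ ζ + (1 - l) • ψ ζ := by
      have e : (ζ - b) * (ζ - 1 / b) / (ζ - 1 / a) = (l : ℂ) * (ζ - a) := by
        rw [← hl]
        field_simp [hne ζ hζ.le]
      rw [hσ]
      simp only [e, mul_smul, hgs, Complex.coe_smul]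
      module
    rw [this]
    exact hc (hφm hmem) (hψm hmem) hl0 (by linarith) (by ring)
  refine ⟨σ, hσd.mono Metric.ball_subset_closedBall,
    fun ζ hζ => mem_of_sphere_mem hc ho hσd hσm (by simpa using hζ), ?_, ?_⟩
  · have h0 := hgs 0
    have e : ((0 : ℂ) - b) * (0 - 1 / b) / (0 - 1 / a) = 0 - a := by
      field_simp
      simp
    simp only [hσ, e, h0]
    abel
  · simp [hσ]

/-- The second disc is precomposed with the automorphism taking tanh s to 0 and tanh(s + t) to tanh
t, so that both discs agree at tanh s. The slack s + t < u pays for the dilation by c < 1 that makes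
both discs holomorphic beyond the closed unit disc, as the gluing requires. -/
theorem HasDisc.trans_of_lt (hc : Convex ℝ D) (ho : IsOpen D) (hs : 0 < s) (ht : 0 < t)
    (h₁ : HasDisc D s z w) (h₂ : HasDisc D t w y) {u : ℝ} (hu : s + t < u) :
    HasDisc D u z y := by
  obtain ⟨φ, hφ, hφm, rfl, hφw⟩ := h₁
  obtain ⟨ψ, hψ, hψm, hψw, rfl⟩ := h₂
  have hn : ‖-((Real.tanh s : ℝ) : ℂ)‖ < 1 := by simpa using tanh_mem_ball s
  set m : ℂ → ℂ := fun ζ => (ζ + -((Real.tanh s : ℝ) : ℂ)) /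
    (1 + (starRingEnd ℂ) (-((Real.tanh s : ℝ) : ℂ)) * ζ) with hm
  have hms : m (Real.tanh s : ℝ) = 0 := by simp [hm]
  have hmst : m (Real.tanh (s + t) : ℝ) = (Real.tanh t : ℝ) := by
    have := tanh_sub (s + t) s
    rw [add_sub_cancel_left] at this
    rw [this, hm]
    simp only [map_neg, Complex.conj_ofReal]
    push_cast
    ring
  have hsp := tanh_pos hs
  have hst : Real.tanh s < Real.tanh (s + t) := tanh_lt_tanh_iff.2 (by linarith)
  have hstu : Real.tanh (s + t) < Real.tanh u := tanh_lt_tanh_iff.2 hu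
  have hu1 := Real.tanh_lt_one u
  have hup : 0 < Real.tanh u := by linarith
  set c : ℝ := Real.tanh (s + t) / Real.tanh u with hc'
  have hc0 : 0 < c := div_pos (hsp.trans hst) hup
  have hc1 : c < 1 := (div_lt_one hup).2 hstu
  have hcC : (c : ℂ) ≠ 0 := by exact_mod_cast hc0.ne'
  have hball : MapsTo (fun ζ : ℂ => (c : ℂ) * ζ) (Metric.ball 0 (1 / c)) (Metric.ball 0 1) := by
    intro ζ hζ
    simp only [mem_ball_zero_iff, norm_mul, Complex.norm_real, Real.norm_of_nonneg hc0.le] at hζ ⊢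
    rwa [lt_div_iff₀' hc0] at hζ
  have hmd := differentiableOn_mobius hn
  have hmm := mapsTo_mobius hn
  have e1 : (c : ℂ) * (Real.tanh s / c : ℝ) = (Real.tanh s : ℝ) := by
    rw [← Complex.ofReal_mul, mul_div_cancel₀ _ hc0.ne']
  have e2 : (c : ℂ) * (Real.tanh u : ℝ) = (Real.tanh (s + t) : ℝ) := by
    rw [← Complex.ofReal_mul, hc', div_mul_cancel₀ _ hup.ne']
  obtain ⟨σ, h1, h2, h3, h4⟩ := glue_discs (φ := fun ζ => φ (c * ζ)) (ψ := fun ζ => ψ (m (c * ζ)))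
    (ρ := 1 / c) (a := Real.tanh s / c) (b := Real.tanh u) hc ho ((one_lt_div hc0).2 hc1)
    (hφ.comp (by fun_prop) hball) (hψ.comp (hmd.comp (by fun_prop) hball) (hmm.comp hball))
    (hφm.comp hball) (hψm.comp (hmm.comp hball)) (by positivity)
    (by rw [div_lt_iff₀ hc0, hc', mul_div_cancel₀ _ hup.ne']; exact hst) hu1
    (by simp only [e1, hms, hφw, hψw])
  refine ⟨σ, h1, h2, by simpa using h3, ?_⟩
  rw [h4, e2, hmst]

theorem HasDisc.of_lempertFun_lt (h : lempertFun D z w < ENNReal.ofReal t) : HasDisc D t z w := by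
  obtain ⟨r, ⟨φ, ζ₀, ζ₁, h₀, h₁, hφ, hm, rfl, rfl, rfl⟩, hr⟩ := sInf_lt_iff.1 h
  have hd := HasDisc.of_points hφ hm h₀ h₁
  have hlt := ENNReal.ofReal_lt_ofReal_iff'.1 hr
  refine hd.mono ?_ hlt.1.le
  have h₀' : ‖-ζ₀‖ < 1 := by simpa using h₀
  have h₁' : ‖ζ₁‖ < 1 := by simpa using h₁
  have e : ‖(ζ₀ - ζ₁) / (1 - (starRingEnd ℂ) ζ₀ * ζ₁)‖ < 1 := by
    rw [norm_pseudohyperbolic]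
    exact norm_mobius_lt_one h₀' h₁'
  rw [poincareDist]
  refine mul_nonneg (by norm_num) (Real.log_nonneg ?_)
  rw [le_div_iff₀ (by linarith)]
  linarith [norm_nonneg ((ζ₀ - ζ₁) / (1 - (starRingEnd ℂ) ζ₀ * ζ₁))]

theorem HasDisc.lempertFun_le (ht : 0 ≤ t) (h : HasDisc D t z w) :
    lempertFun D z w ≤ ENNReal.ofReal t := by
  obtain ⟨φ, hφ, hm, rfl, rfl⟩ := h
  refine sInf_le ⟨φ, 0, (Real.tanh t : ℝ), by simp, tanh_mem_ball t, hφ, hm, rfl, rfl, ?_⟩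
  have := poincareDist_tanh 0 t
  rw [Real.tanh_zero, Complex.ofReal_zero] at this
  rw [this]
  simp [abs_of_nonneg ht]

theorem HasDisc.kobayashiEDist_le (ht : 0 ≤ t) (h : HasDisc D t z w) :
    kobayashiEDist D z w ≤ ENNReal.ofReal t := by
  refine le_trans (sInf_le ⟨1, fun j => if j = 0 then z else w, by simp, by simp, ?_, rfl⟩) ?_
  · intro j _
    dsimp only
    split_ifs
    exacts [h.left_mem, h.right_mem]
  · simpa using h.lempertFun_le ht

theorem HasDisc.of_chain (hc : Convex ℝ D) (ho : IsOpen D) (k : ℕ) (p : ℕ → Cn n)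
    (hp : ∀ j ≤ k, p j ∈ D) :
    ∀ t : ℝ, ∑ j ∈ Finset.range k, lempertFun D (p j) (p (j + 1)) < ENNReal.ofReal t →
      HasDisc D t (p 0) (p k) := by
  induction k with
  | zero => exact fun t _ => HasDisc.refl (hp 0 le_rfl) t
  | succ k ih =>
    intro t ht
    rw [Finset.sum_range_succ] at ht
    set A := ∑ j ∈ Finset.range k, lempertFun D (p j) (p (j + 1))
    set B := lempertFun D (p k) (p (k + 1))
    have hA : A ≠ ∞ := ne_top_of_lt (lt_of_le_of_lt le_self_add ht)
    have hB : B ≠ ∞ := ne_top_of_lt (lt_of_le_of_lt le_add_self ht)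
    have ht' : A.toReal + B.toReal < t := by
      rw [← ENNReal.toReal_add hA hB]
      exact (ENNReal.lt_ofReal_iff_toReal_lt (ne_top_of_lt ht)).1 ht
    -- One third of the slack for each of the two pieces, and one for the strict inequality in the
    -- gluing.
    set ε := (t - (A.toReal + B.toReal)) / 3 with hε
    have hε0 : 0 < ε := by rw [hε]; linarith
    have h1 := ih (fun j hj => hp j (hj.trans k.le_succ)) (A.toReal + ε)
      ((ENNReal.lt_ofReal_iff_toReal_lt hA).2 (by linarith))
    have h2 : HasDisc D (B.toReal + ε) (p k) (p (k + 1)) := HasDisc.of_lempertFun_lt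
      ((ENNReal.lt_ofReal_iff_toReal_lt hB).2 (by linarith))
    have hA0 := ENNReal.toReal_nonneg (a := A)
    have hB0 := ENNReal.toReal_nonneg (a := B)
    exact h1.trans_of_lt hc ho (by linarith) (by linarith) h2 (by linarith)

/-- On an open convex set the Kobayashi distance is realized by single discs. -/
theorem HasDisc.of_kobayashiEDist_lt (hc : Convex ℝ D) (ho : IsOpen D)
    (h : kobayashiEDist D z w < ENNReal.ofReal t) : HasDisc D t z w := by
  obtain ⟨r, ⟨k, p, rfl, rfl, hp, rfl⟩, hr⟩ := sInf_lt_iff.1 h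
  exact HasDisc.of_chain hc ho k p hp t hr

/-- Affine discs give the relation locally, gluing gives transitivity, and connectedness of D does
the rest. -/
theorem exists_hasDisc (hc : Convex ℝ D) (ho : IsOpen D) (hz : z ∈ D) (hw : w ∈ D) :
    ∃ t, 0 < t ∧ HasDisc D t z w := by
  refine hc.isPreconnected.induction₂ (fun z w => ∃ t, 0 < t ∧ HasDisc D t z w) ?_ ?_ ?_ hz hw
  · intro x hx
    obtain ⟨r, hr, hb⟩ := Metric.isOpen_iff.1 ho x hx
    have h1 : 0 < r * Real.tanh 1 := mul_pos hr (tanh_pos one_pos)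
    filter_upwards [mem_nhdsWithin_of_mem_nhds (Metric.ball_mem_nhds x h1)] with y hy
    exact ⟨1, one_pos, HasDisc.of_ball hb hr one_pos (mem_ball_iff_norm.1 hy).le⟩
  · rintro x y z - - - ⟨s, hs, h1⟩ ⟨t, ht, h2⟩
    exact ⟨s + t + 1, by linarith, h1.trans_of_lt hc ho hs ht h2 (by linarith)⟩
  · rintro x y - - ⟨s, hs, h⟩
    exact ⟨s, hs, h.symm hs.le⟩

theorem kobayashiEDist_ne_top (hc : Convex ℝ D) (ho : IsOpen D) (hz : z ∈ D) (hw : w ∈ D) :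
    kobayashiEDist D z w ≠ ∞ := by
  obtain ⟨t, ht, h⟩ := exists_hasDisc hc ho hz hw
  exact ne_top_of_le_ne_top ENNReal.ofReal_ne_top (h.kobayashiEDist_le ht.le)

theorem HasDisc.of_kobayashiDist_lt (hc : Convex ℝ D) (ho : IsOpen D) (hz : z ∈ D) (hw : w ∈ D)
    (h : kobayashiDist D z w < t) : HasDisc D t z w :=
  HasDisc.of_kobayashiEDist_lt hc ho
    ((ENNReal.lt_ofReal_iff_toReal_lt (kobayashiEDist_ne_top hc ho hz hw)).2 h)

theorem HasDisc.kobayashiDist_le (ht : 0 ≤ t) (h : HasDisc D t z w) : kobayashiDist D z w ≤ t :=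
  ENNReal.toReal_le_of_le_ofReal ht (h.kobayashiEDist_le ht)

theorem kobayashiDist_nonneg : 0 ≤ kobayashiDist D z w := ENNReal.toReal_nonneg

theorem kobayashiDist_self (hz : z ∈ D) : kobayashiDist D z z = 0 :=
  le_antisymm ((HasDisc.refl hz 0).kobayashiDist_le le_rfl) kobayashiDist_nonneg

theorem kobayashiDist_comm (hc : Convex ℝ D) (ho : IsOpen D) (hz : z ∈ D) (hw : w ∈ D) :
    kobayashiDist D z w = kobayashiDist D w z := by
  have key : ∀ {z w}, z ∈ D → w ∈ D → kobayashiDist D z w ≤ kobayashiDist D w z := by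
    intro z w hz hw
    refine le_of_forall_gt_imp_ge_of_dense fun t ht => ?_
    have ht0 : 0 ≤ t := kobayashiDist_nonneg.trans ht.le
    exact ((HasDisc.of_kobayashiDist_lt hc ho hw hz ht).symm ht0).kobayashiDist_le ht0
  exact le_antisymm (key hz hw) (key hw hz)

theorem kobayashiDist_triangle (hc : Convex ℝ D) (ho : IsOpen D) (hz : z ∈ D) (hw : w ∈ D)
    (hy : y ∈ D) : kobayashiDist D z y ≤ kobayashiDist D z w + kobayashiDist D w y := by
  refine le_of_forall_pos_le_add fun ε hε => ?_
  have h1 := HasDisc.of_kobayashiDist_lt hc ho hz hw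
    (show kobayashiDist D z w < kobayashiDist D z w + ε / 3 by linarith)
  have h2 := HasDisc.of_kobayashiDist_lt hc ho hw hy
    (show kobayashiDist D w y < kobayashiDist D w y + ε / 3 by linarith)
  have p1 : 0 ≤ kobayashiDist D z w := kobayashiDist_nonneg
  have p2 : 0 ≤ kobayashiDist D w y := kobayashiDist_nonneg
  exact (h1.trans_of_lt hc ho (by linarith) (by linarith) h2 (by linarith)).kobayashiDist_le
    (by linarith)

theorem kobayashiDist_map_le (hc : Convex ℝ D) (ho : IsOpen D) {f : Cn n → Cn n}
    (hf : DifferentiableOn ℂ f D) (hm : MapsTo f D D) (hz : z ∈ D) (hw : w ∈ D) :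
    kobayashiDist D (f z) (f w) ≤ kobayashiDist D z w := by
  refine le_of_forall_gt_imp_ge_of_dense fun t ht => ?_
  exact ((HasDisc.of_kobayashiDist_lt hc ho hz hw ht).comp hf hm).kobayashiDist_le
    (kobayashiDist_nonneg.trans ht.le)

/-- Convexity of Kobayashi balls: a convex combination of two discs of the same length ending at w
is again a disc in D ending at w. -/
theorem kobayashiDist_combo_lt (hc : Convex ℝ D) (ho : IsOpen D) {z' : Cn n} (hz : z ∈ D)
    (hz' : z' ∈ D) (hw : w ∈ D) (h : kobayashiDist D z w < t) (h' : kobayashiDist D z' w < t)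
    {a b : ℝ} (ha : 0 ≤ a) (hb : 0 ≤ b) (hab : a + b = 1) :
    kobayashiDist D (a • z + b • z') w < t := by
  obtain ⟨r, hr, hrt⟩ := exists_between (max_lt h h')
  have hr0 : 0 ≤ r := kobayashiDist_nonneg.trans ((le_max_left _ _).trans hr.le)
  have := (HasDisc.of_kobayashiDist_lt hc ho hz hw ((le_max_left _ _).trans_lt hr)).combo hc
    (HasDisc.of_kobayashiDist_lt hc ho hz' hw ((le_max_right _ _).trans_lt hr)) ha hb hab
  rw [← add_smul, hab, one_smul] at this
  exact (this.kobayashiDist_le hr0).trans_lt hrt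

theorem tendsto_kobayashiDist_self (ho : IsOpen D) (hz : z ∈ D) :
    Tendsto (fun w => kobayashiDist D z w) (𝓝 z) (𝓝 0) := by
  obtain ⟨r, hr, hb⟩ := Metric.isOpen_iff.1 ho z hz
  rw [Metric.tendsto_nhds]
  intro ε hε
  have h2 : 0 < ε / 2 := by linarith
  have h1 : 0 < r * Real.tanh (ε / 2) := mul_pos hr (tanh_pos h2)
  filter_upwards [Metric.ball_mem_nhds z h1] with y hy
  have := (HasDisc.of_ball hb hr h2 (mem_ball_iff_norm.1 hy).le).kobayashiDist_le h2.le
  rw [Real.dist_eq, sub_zero, abs_of_nonneg kobayashiDist_nonneg]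
  linarith

end

/-! ### Schwarz and Harnack estimates, and compactness of Kobayashi balls -/

/-- Harnack's inequality for positive real parts on the unit disc. -/
theorem harnack_re {u : ℂ → ℂ} (hu : DifferentiableOn ℂ u (Metric.ball 0 1))
    (hpos : ∀ ζ : ℂ, ‖ζ‖ < 1 → 0 < (u ζ).re) {r : ℝ} (hr0 : 0 ≤ r) (hr1 : r < 1) :
    (1 - r) * (u 0).re ≤ (1 + r) * (u r).re := by
  set c := u 0 with hc
  have hc0 : 0 < c.re := hpos 0 (by simp)
  have hne : ∀ ζ : ℂ, ‖ζ‖ < 1 → u ζ + (starRingEnd ℂ) c ≠ 0 := by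
    intro ζ hζ h
    have := congrArg Complex.re h
    simp only [Complex.add_re, Complex.conj_re, Complex.zero_re] at this
    linarith [hpos ζ hζ]
  have hsq : ∀ ζ : ℂ, Complex.normSq (u ζ + (starRingEnd ℂ) c) - Complex.normSq (u ζ - c) =
      4 * (u ζ).re * c.re := by
    intro ζ
    simp only [Complex.normSq_apply, Complex.add_re, Complex.add_im, Complex.sub_re,
      Complex.sub_im, Complex.conj_re, Complex.conj_im]
    ring
  -- A Cayley transform of the right half plane sending c = u(0) to 0; the Schwarz lemma applies to
  -- it.
  have hd : DifferentiableOn ℂ (fun ζ => (u ζ - c) / (u ζ + (starRingEnd ℂ) c))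
      (Metric.ball 0 1) :=
    (hu.sub_const c).div (hu.add_const _) fun ζ hζ => hne ζ (by simpa using hζ)
  have hmaps : MapsTo (fun ζ => (u ζ - c) / (u ζ + (starRingEnd ℂ) c)) (Metric.ball 0 1)
      (Metric.closedBall 0 1) := by
    intro ζ hζ
    have hζ' : ‖ζ‖ < 1 := by simpa using hζ
    rw [mem_closedBall_zero_iff, norm_div, div_le_one (norm_pos_iff.2 (hne ζ hζ'))]
    refine le_of_sq_le_sq ?_ (norm_nonneg _)
    rw [← Complex.normSq_eq_norm_sq, ← Complex.normSq_eq_norm_sq]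
    nlinarith [hsq ζ, mul_pos (hpos ζ hζ') hc0]
  have hrn : ‖(r : ℂ)‖ < 1 := by rwa [Complex.norm_real, Real.norm_of_nonneg hr0]
  have h := Complex.norm_le_norm_of_mapsTo_ball hd hmaps (by simp [hc]) hrn
  have hp := hpos r hrn
  rw [Complex.norm_real, Real.norm_of_nonneg hr0, norm_div,
    div_le_iff₀ (norm_pos_iff.2 (hne r hrn))] at h
  have h2 := pow_le_pow_left₀ (norm_nonneg _) h 2
  rw [mul_pow, ← Complex.normSq_eq_norm_sq, ← Complex.normSq_eq_norm_sq] at h2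
  simp only [Complex.normSq_apply, Complex.add_re, Complex.add_im, Complex.sub_re,
    Complex.sub_im, Complex.conj_re, Complex.conj_im] at h2
  have hr2 : r ^ 2 ≤ 1 := by nlinarith
  have h3 : (c.re - (u r).re) ^ 2 ≤ (r * (c.re + (u r).re)) ^ 2 := by
    nlinarith [mul_nonneg (sub_nonneg.2 hr2) (sq_nonneg ((u r).im - c.im))]
  have h4 := abs_le_of_sq_le_sq' h3 (by positivity)
  nlinarith [h4.2]

section
variable {n : ℕ} {D : Set (Cn n)} {z w y z₀ : Cn n} {s t : ℝ}

theorem HasDisc.norm_sub_le {M : ℝ} (hM : ∀ z ∈ D, ∀ w ∈ D, ‖z - w‖ ≤ M) (ht : 0 ≤ t)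
    (h : HasDisc D t z w) : ‖w - z‖ ≤ M * Real.tanh t := by
  obtain ⟨φ, hφ, hm, rfl, rfl⟩ := h
  have := Complex.dist_le_div_mul_dist_of_mapsTo_ball hφ (R₂ := M) (c := 0) (fun ζ hζ => by
    rw [mem_closedBall_iff_norm]
    exact hM _ (hm hζ) _ (hm (by simp))) (tanh_mem_ball t)
  rwa [dist_eq_norm, dist_zero_right, Complex.norm_real, Real.norm_of_nonneg (tanh_nonneg ht),
    div_one] at this

theorem exists_diam_bound (hb : Bornology.IsBounded D) :
    ∃ M : ℝ, 0 < M ∧ ∀ z ∈ D, ∀ w ∈ D, ‖z - w‖ ≤ M := by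
  obtain ⟨M, hM⟩ := Metric.isBounded_iff.1 hb
  exact ⟨max M 1, by positivity, fun z hz w hw => by
    rw [← dist_eq_norm]; exact (hM hz hw).trans (le_max_left _ _)⟩

theorem kobayashiDist_pos (hc : Convex ℝ D) (ho : IsOpen D) (hb : Bornology.IsBounded D)
    (hz : z ∈ D) (hw : w ∈ D) (hzw : z ≠ w) : 0 < kobayashiDist D z w := by
  obtain ⟨M, hM0, hM⟩ := exists_diam_bound hb
  have h0 : 0 < ‖w - z‖ := norm_pos_iff.2 (sub_ne_zero.2 hzw.symm)
  have hle : ‖w - z‖ / M ≤ 1 := (div_le_one hM0).2 (hM _ hw _ hz)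
  have hp : 0 < ‖w - z‖ / M := div_pos h0 hM0
  -- With this t, the Schwarz estimate for a disc of length t would give ‖w - z‖ ≤ ‖w - z‖ / 2.
  obtain ⟨t, ht⟩ := exists_tanh_eq (r := ‖w - z‖ / M / 2) (by linarith) (by linarith)
  have ht0 : 0 < t := tanh_lt_tanh_iff.1 (by rw [ht, Real.tanh_zero]; positivity)
  by_contra hn
  have := (HasDisc.of_kobayashiDist_lt hc ho hz hw
    (t := t) (by linarith)).norm_sub_le hM ht0.le
  rw [ht] at this
  have e : M * (‖w - z‖ / M / 2) = ‖w - z‖ / 2 := by field_simp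
  linarith

theorem isCompact_homothety (hb : Bornology.IsBounded D) (s : ℝ) (z₀ : Cn n) :
    IsCompact ((fun y => (1 - s) • y + s • z₀) '' closure D) :=
  hb.isCompact_closure.image (by fun_prop)

theorem homothety_subset (hc : Convex ℝ D) (ho : IsOpen D) (hz₀ : z₀ ∈ D) (hs : 0 < s)
    (hs1 : s ≤ 1) : (fun y => (1 - s) • y + s • z₀) '' closure D ⊆ D := by
  rintro _ ⟨y, hy, rfl⟩
  have := hc.combo_closure_interior_mem_interior hy (by rwa [ho.interior_eq])
    (sub_nonneg.2 hs1) hs (by ring) (y := z₀)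
  rwa [ho.interior_eq] at this

/-- If (w - εz₀)/(1 - ε), with ε the Harnack constant (1 - r)/(1 + r), were outside the closure of
D, a functional L and a level c would separate them; Harnack's inequality for c - Re L along the
disc then gives a contradiction. The case r = 0, where 1 - ε vanishes, is separate. -/
theorem HasDisc.mem_homothety (hc : Convex ℝ D) (ht : 0 ≤ t) (h : HasDisc D t z₀ w) :
    w ∈ (fun y => (1 - (1 - Real.tanh t) / (1 + Real.tanh t)) • y +
      ((1 - Real.tanh t) / (1 + Real.tanh t)) • z₀) '' closure D := by
  have hr0 := tanh_nonneg ht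
  have hr1 := Real.tanh_lt_one t
  set r := Real.tanh t with hr
  rcases hr0.eq_or_lt with h0 | h0
  · obtain ⟨φ, hφ, hm, rfl, rfl⟩ := h
    refine ⟨φ 0, subset_closure (hm (by simp)), ?_⟩
    rw [← hr, ← h0]
    simp
  set ε := (1 - r) / (1 + r) with hε
  have hε1 : 1 - ε = 2 * r / (1 + r) := by rw [hε]; field_simp; ring
  have hε1' : 0 < 1 - ε := by rw [hε1]; positivity
  refine ⟨(1 - ε)⁻¹ • (w - ε • z₀), ?_, ?_⟩
  · by_contra hn
    obtain ⟨L, c, hL, hLc⟩ := RCLike.geometric_hahn_banach_closed_point (𝕜 := ℂ)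
      hc.closure isClosed_closure hn
    obtain ⟨φ, hφ, hm, rfl, rfl⟩ := h
    have hh := harnack_re (u := fun ζ => (c : ℂ) - L (φ ζ))
      ((L.differentiable.comp_differentiableOn hφ).const_sub _) (fun ζ hζ => by
        have := hL _ (subset_closure (hm (show ζ ∈ Metric.ball (0 : ℂ) 1 by simpa using hζ)))
        simpa using this) hr0 hr1
    have e : L ((1 - ε)⁻¹ • (φ (r : ℝ) - ε • φ 0)) =
        ((1 - ε)⁻¹ : ℝ) * (L (φ (r : ℝ)) - (ε : ℝ) * L (φ 0)) := by
      rw [← Complex.coe_smul, ← Complex.coe_smul, map_smul, map_sub, map_smul]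
      simp
    rw [e] at hLc
    simp only [RCLike.re_eq_complex_re, Complex.re_ofReal_mul, Complex.sub_re,
      Complex.ofReal_re] at hLc hh
    rw [lt_inv_mul_iff₀ hε1'] at hLc
    have h1r : ε * (1 + r) = 1 - r := by rw [hε]; field_simp
    have h5 : (1 + r) * ((1 - ε) * c) < (1 + r) * ((L (φ r)).re - ε * (L (φ 0)).re) :=
      mul_lt_mul_of_pos_left hLc (by linarith)
    have h6 : (1 + r) * ((1 - ε) * c) = (1 + r) * c - (1 - r) * c := by
      linear_combination (-c) * h1r
    have h7 : (1 + r) * ((L (φ r)).re - ε * (L (φ 0)).re) =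
        (1 + r) * (L (φ r)).re - (1 - r) * (L (φ 0)).re := by
      linear_combination (-(L (φ 0)).re) * h1r
    linarith
  · dsimp only
    rw [smul_inv_smul₀ hε1'.ne']
    abel

/-- Kobayashi balls are relatively compact. -/
theorem exists_compact_of_kobayashiDist_le (hc : Convex ℝ D) (ho : IsOpen D)
    (hb : Bornology.IsBounded D) (hz₀ : z₀ ∈ D) (C : ℝ) :
    ∃ K ⊆ D, IsCompact K ∧ ∀ w ∈ D, kobayashiDist D z₀ w ≤ C → w ∈ K := by
  set t := max C 0 + 1 with ht
  have ht0 : 0 ≤ t := by positivity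
  have hr0 := tanh_nonneg ht0
  have hr1 := Real.tanh_lt_one t
  refine ⟨_, homothety_subset hc ho hz₀ (s := (1 - Real.tanh t) / (1 + Real.tanh t)) ?_ ?_,
    isCompact_homothety hb _ z₀, fun w hw h => ?_⟩
  · exact div_pos (by linarith) (by linarith)
  · rw [div_le_one (by linarith)]; linarith
  · exact (HasDisc.of_kobayashiDist_lt hc ho hz₀ hw (t := t)
      (by linarith [le_max_left C 0])).mem_homothety hc ht0

theorem tendsto_kobayashiDist (hc : Convex ℝ D) (ho : IsOpen D) {ι : Type*} {l : Filter ι}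
    {u v : ι → Cn n} (hz : z ∈ D) (hw : w ∈ D) (hu : Tendsto u l (𝓝 z)) (hv : Tendsto v l (𝓝 w)) :
    Tendsto (fun i => kobayashiDist D (u i) (v i)) l (𝓝 (kobayashiDist D z w)) := by
  have h1 := (tendsto_kobayashiDist_self ho hz).comp hu
  have h2 := (tendsto_kobayashiDist_self ho hw).comp hv
  refine tendsto_iff_dist_tendsto_zero.2 (squeeze_zero' (Eventually.of_forall fun _ => dist_nonneg)
    ?_ (by simpa using h1.add h2))
  filter_upwards [hu.eventually_mem (ho.mem_nhds hz), hv.eventually_mem (ho.mem_nhds hw)]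
    with i hi hi'
  rw [Real.dist_eq, abs_le]
  have a1 := kobayashiDist_triangle hc ho hz hi hw
  have a2 := kobayashiDist_triangle hc ho hi hi' hw
  have a3 := kobayashiDist_triangle hc ho hi hz hi'
  have a4 := kobayashiDist_triangle hc ho hz hw hi'
  rw [kobayashiDist_comm hc ho hi' hw] at a2
  rw [kobayashiDist_comm hc ho hi hz] at a3
  constructor <;> linarith

/-! ### Strict contraction by homotheties and fixed points of perturbed maps -/

/-- A homothety towards an interior point shrinks discs by a uniform factor. -/
theorem exists_factor_homothety (hc : Convex ℝ D) (ho : IsOpen D) (hb : Bornology.IsBounded D)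
    (hz₀ : z₀ ∈ D) (hs : 0 < s) (hs1 : s ≤ 1) {r₀ : ℝ} (hr₀ : r₀ < 1) :
    ∃ a : ℝ, 0 < a ∧ a < 1 ∧ ∀ t, 0 < t → Real.tanh t ≤ r₀ → ∀ z w, HasDisc D t z w →
      ∀ t', a * Real.tanh t ≤ Real.tanh t' →
        HasDisc D t' ((1 - s) • z + s • z₀) ((1 - s) • w + s • z₀) := by
  obtain ⟨M, hM0, hM⟩ := exists_diam_bound hb
  obtain ⟨ρ, hρ, hball⟩ := Metric.isOpen_iff.1 ho z₀ hz₀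
  have hr₀' : 0 < 1 - r₀ := by linarith
  have hq : 0 < s * ρ * (1 - r₀) := by positivity
  -- This balance makes the displacement φ(r) - φ(ar) at most sρ·ar, which is what the ball of
  -- radius ρ about z₀ can absorb.
  obtain ⟨a, ha0, ha1, hMa⟩ : ∃ a : ℝ, 0 < a ∧ a < 1 ∧ M * (1 - a) = s * ρ * (1 - r₀) * a :=
    ⟨M / (M + s * ρ * (1 - r₀)), by positivity, (div_lt_one (by positivity)).2 (by linarith),
      by field_simp; ring⟩
  refine ⟨a, ha0, ha1, fun t ht htr z w h t' ht' => ?_⟩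
  obtain ⟨φ, hφ, hm, rfl, rfl⟩ := h
  have hr0 := tanh_pos ht
  have hr1 := Real.tanh_lt_one t
  set r := Real.tanh t with hr
  have har : 0 < a * r := mul_pos ha0 hr0
  have hsub : Metric.ball (r : ℂ) (1 - r) ⊆ Metric.ball 0 1 := by
    refine Metric.ball_subset_ball' ?_
    rw [dist_zero_right, Complex.norm_real, Real.norm_of_nonneg hr0.le]
    linarith
  have hdist : dist ((a * r : ℝ) : ℂ) (r : ℂ) = (1 - a) * r := by
    rw [dist_eq_norm, ← Complex.ofReal_sub, Complex.norm_real, Real.norm_eq_abs,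
      abs_of_nonpos (by nlinarith)]
    ring
  have hle : ‖φ r - φ (a * r : ℝ)‖ * (1 - r) ≤ M * ((1 - a) * r) := by
    -- If ar lies in the disc of radius 1 - r about r, the Schwarz lemma applies there; otherwise
    -- the diameter bound M suffices.
    rcases lt_or_ge ((1 - a) * r) (1 - r) with hlt | hge
    · have := Complex.dist_le_div_mul_dist_of_mapsTo_ball (hφ.mono hsub) (R₂ := M)
        (fun ζ hζ => by
          rw [mem_closedBall_iff_norm]
          exact hM _ (hm (hsub hζ)) _ (hm (tanh_mem_ball t)))
        (show ((a * r : ℝ) : ℂ) ∈ _ by rw [Metric.mem_ball, hdist]; exact hlt)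
      rw [hdist, dist_comm, dist_eq_norm, div_mul_eq_mul_div, le_div_iff₀ (by linarith)] at this
      exact this
    · have h1 : ‖φ r - φ (a * r : ℝ)‖ ≤ M := hM _ (hm (tanh_mem_ball t)) _ (hm (by
        rw [mem_ball_zero_iff, Complex.norm_real, Real.norm_of_nonneg har.le]; nlinarith))
      calc _ ≤ M * (1 - r) := by gcongr
        _ ≤ _ := by gcongr
  have hle' : ‖φ r - φ (a * r : ℝ)‖ ≤ s * ρ * (a * r) := by
    refine le_of_mul_le_mul_right (hle.trans ?_) (show 0 < 1 - r by linarith)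
    calc M * ((1 - a) * r) = s * ρ * (a * r) * (1 - r₀) := by linear_combination r * hMa
      _ ≤ s * ρ * (a * r) * (1 - r) := by gcongr
  set v := φ r - φ (a * r : ℝ) with hv
  -- The centre z₀ is replaced by a point moving linearly in its ball, so that already at the
  -- parameter ar the disc reaches the homothetic image of φ(r).
  set χ : ℂ → Cn n := fun ζ => (1 - s) • φ ζ + s • (z₀ + ((ζ / (a * r : ℝ)) • (((1 - s) / s) • v)))
    with hχ
  have hχd : DifferentiableOn ℂ χ (Metric.ball 0 1) :=
    (hφ.const_smul (1 - s)).add (by fun_prop)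
  have hχm : MapsTo χ (Metric.ball 0 1) D := by
    intro ζ hζ
    have hζ' : ‖ζ‖ < 1 := by simpa using hζ
    refine hc (hm hζ) (hball ?_) (by linarith) hs.le (by ring)
    rw [mem_ball_iff_norm, add_sub_cancel_left, norm_smul, norm_div, Complex.norm_real,
      Real.norm_of_nonneg har.le, norm_smul, Real.norm_of_nonneg (div_nonneg (by linarith) hs.le)]
    calc ‖ζ‖ / (a * r) * ((1 - s) / s * ‖v‖)
        ≤ ‖ζ‖ / (a * r) * (1 / s * (s * ρ * (a * r))) := by
          have : (1 - s) / s ≤ 1 / s := by gcongr; linarith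
          gcongr
      _ = ‖ζ‖ * ρ := by field_simp
      _ < 1 * ρ := by gcongr
      _ = ρ := one_mul ρ
  have h0 : χ 0 = (1 - s) • φ 0 + s • z₀ := by simp [hχ]
  have h1 : χ (a * r : ℝ) = (1 - s) • φ r + s • z₀ := by
    have : ((a * r : ℝ) : ℂ) ≠ 0 := by exact_mod_cast har.ne'
    simp only [hχ]
    rw [div_self this, one_smul, smul_add, smul_smul, mul_div_cancel₀ _ hs.ne', hv, smul_sub]
    abel
  rw [← h0, ← h1]
  exact HasDisc.of_scaled hχd hχm har.le ht'

theorem kobayashiDist_homothety_lt (hc : Convex ℝ D) (ho : IsOpen D) (hb : Bornology.IsBounded D)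
    (hz₀ : z₀ ∈ D) (hs : 0 < s) (hs1 : s ≤ 1) (hz : z ∈ D) (hw : w ∈ D) (hzw : z ≠ w) :
    kobayashiDist D ((1 - s) • z + s • z₀) ((1 - s) • w + s • z₀) < kobayashiDist D z w := by
  set k := kobayashiDist D z w with hk
  have hk0 : 0 < k := kobayashiDist_pos hc ho hb hz hw hzw
  -- The infimum k need not be attained, so the factor must be uniform over discs slightly longer
  -- than k; k + 1 leaves that room.
  obtain ⟨a, ha0, ha1, h⟩ := exists_factor_homothety hc ho hb hz₀ hs hs1
    (Real.tanh_lt_one (k + 1))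
  have hT := tanh_pos hk0
  have hT1 := Real.tanh_lt_one k
  obtain ⟨m, hm1, hm2⟩ := exists_between (show a * Real.tanh k < Real.tanh k by nlinarith)
  have hm0 : 0 < m := (mul_pos ha0 hT).trans hm1
  obtain ⟨t', rfl⟩ := exists_tanh_eq (r := m) (by linarith) (by linarith)
  have h2 : Real.tanh k < min (Real.tanh t' / a) (Real.tanh (k + 1)) :=
    lt_min ((lt_div_iff₀' ha0).2 hm1) (tanh_lt_tanh_iff.2 (by linarith))
  obtain ⟨q, hq1, hq2⟩ := exists_between h2
  have hq3 := hq2.trans_le (min_le_right _ _)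
  have hq4 := hq2.trans_le (min_le_left _ _)
  obtain ⟨t, rfl⟩ := exists_tanh_eq (r := q) (by linarith)
    (by linarith [Real.tanh_lt_one (k + 1)])
  have hkt := tanh_lt_tanh_iff.1 hq1
  have ht'0 : 0 < t' := tanh_lt_tanh_iff.1 (by simpa using hm0)
  exact ((h t (by linarith) hq3.le z w (HasDisc.of_kobayashiDist_lt hc ho hz hw hkt) t'
    ((lt_div_iff₀' ha0).1 hq4).le).kobayashiDist_le ht'0.le).trans_lt (tanh_lt_tanh_iff.1 hm2)

/-- Edelstein's argument: at a minimum of k_D(g w, w) on K, a point that is not fixed would be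
improved by its own image. -/
theorem exists_fixedPoint_of_contractive (hc : Convex ℝ D) (ho : IsOpen D) {K : Set (Cn n)}
    (hK : IsCompact K) (hKD : K ⊆ D) (hne : K.Nonempty) {g : Cn n → Cn n} (hg : ContinuousOn g K)
    (hm : MapsTo g K K)
    (hlt : ∀ z ∈ K, ∀ w ∈ K, z ≠ w → kobayashiDist D (g z) (g w) < kobayashiDist D z w) :
    ∃ x ∈ K, g x = x := by
  have hcont : ContinuousOn (fun w => kobayashiDist D (g w) w) K := fun w hw =>
    tendsto_kobayashiDist hc ho (hKD (hm hw)) (hKD hw) (hg w hw)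
      (tendsto_id.mono_left nhdsWithin_le_nhds)
  obtain ⟨x, hx, hmin⟩ := hK.exists_isMinOn hne hcont
  refine ⟨x, hx, ?_⟩
  by_contra hn
  exact absurd (hlt _ (hm hx) _ hx hn) (not_lt.2 (hmin (hm hx)))

/-- The maps `(1 - s) f + s z₀` have fixed points in invariant relatively compact sets. -/
theorem exists_fixedPoint_perturbed (hc : Convex ℝ D) (ho : IsOpen D) (hb : Bornology.IsBounded D)
    {f : Cn n → Cn n} (hf : DifferentiableOn ℂ f D) (hfm : MapsTo f D D) (hz₀ : z₀ ∈ D)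
    (hs : 0 < s) (hs1 : s ≤ 1) {A K : Set (Cn n)} (hK : IsCompact K) (hKD : K ⊆ D) (hAK : A ⊆ K)
    (hA : A.Nonempty) (hm : MapsTo (fun w => (1 - s) • f w + s • z₀) A A) :
    ∃ x ∈ K, (1 - s) • f x + s • z₀ = x := by
  have hcl : closure A ⊆ K := closure_minimal hAK hK.isClosed
  have hcont : ContinuousOn (fun w => (1 - s) • f w + s • z₀) (closure A) := by
    have := hf.continuousOn.mono (hcl.trans hKD)
    fun_prop
  have hlt : ∀ z ∈ closure A, ∀ w ∈ closure A, z ≠ w →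
      kobayashiDist D ((1 - s) • f z + s • z₀) ((1 - s) • f w + s • z₀) < kobayashiDist D z w := by
    intro z hz w hw hzw
    have hz' := hKD (hcl hz)
    have hw' := hKD (hcl hw)
    by_cases hfe : f z = f w
    · have hmem : (1 - s) • f w + s • z₀ ∈ D :=
        homothety_subset hc ho hz₀ hs hs1 (mem_image_of_mem _ (subset_closure (hfm hw')))
      rw [hfe, kobayashiDist_self hmem]
      exact kobayashiDist_pos hc ho hb hz' hw' hzw
    · exact (kobayashiDist_homothety_lt hc ho hb hz₀ hs hs1 (hfm hz') (hfm hw') hfe).trans_le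
        (kobayashiDist_map_le hc ho hf hfm hz' hw')
  obtain ⟨x, hx, h⟩ := exists_fixedPoint_of_contractive hc ho
    (hK.of_isClosed_subset isClosed_closure hcl) (hcl.trans hKD) hA.closure hcont
    (hm.closure_of_continuousOn hcont) hlt
  exact ⟨x, hcl hx, h⟩

end

/-! ### Całka's theorem -/

/-- Całka's theorem in recurrent form: if an orbit of a nonexpansive map of a proper space has a
convergent subsequence, the orbit of the limit is bounded. -/
theorem exists_orbit_bound {X : Type*} [PseudoMetricSpace X] [ProperSpace X] {f : X → X}
    (hf : ∀ a b, dist (f a) (f b) ≤ dist a b) {x y : X} {s : ℕ → ℕ} (hs : StrictMono s)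
    (h : Tendsto (fun i => f^[s i] x) atTop (𝓝 y)) : ∃ C, ∀ k, dist y (f^[k] y) ≤ C := by
  have hit : ∀ (n : ℕ) a b, dist (f^[n] a) (f^[n] b) ≤ dist a b := by
    intro n
    induction n with
    | zero => intro a b; simp
    | succ n ih =>
      intro a b
      rw [Function.iterate_succ_apply, Function.iterate_succ_apply]
      exact (ih _ _).trans (hf a b)
  -- y is recurrent: f^[s j - s i] moves f^[s i] x, which is close to y, to f^[s j] x, which is
  -- close to y as well.
  have hrec : ∀ ε > 0, ∀ N : ℕ, ∃ n, N ≤ n ∧ dist y (f^[n] y) ≤ ε := by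
    intro ε hε N
    obtain ⟨i, hi⟩ := Metric.tendsto_atTop.1 h (ε / 2) (by linarith)
    have h1 : s i + N ≤ s (i + N) := by
      clear hi
      induction N with
      | zero => simp
      | succ N ih => have := hs (show i + N < i + (N + 1) by omega); omega
    refine ⟨s (i + N) - s i, by omega, ?_⟩
    have h2 := hi (i + N) (by omega)
    have h3 := (hit (s (i + N) - s i) (f^[s i] x) y).trans_lt (hi i le_rfl)
    rw [← Function.iterate_add_apply, show s (i + N) - s i + s i = s (i + N) by omega] at h3
    have := dist_triangle_left y (f^[s (i + N) - s i] y) (f^[s (i + N)] x)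
    linarith
  -- Some f^[m] with m ≥ a almost fixes y, so f^[m - a] almost undoes f^[a] along the orbit;
  -- nonexpansiveness then becomes isometry.
  have hiso : ∀ a b : ℕ, a ≤ b → dist y (f^[b - a] y) ≤ dist (f^[a] y) (f^[b] y) := by
    intro a b hab
    refine le_of_forall_pos_le_add fun ε hε => ?_
    obtain ⟨m, hm, hmε⟩ := hrec (ε / 2) (by linarith) a
    have h1 := hit (m - a) (f^[a] y) (f^[b] y)
    have h2 := hit (b - a) (f^[m] y) y
    rw [← Function.iterate_add_apply, ← Function.iterate_add_apply,
      show m - a + a = m by omega] at h1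
    rw [← Function.iterate_add_apply, show b - a + m = m - a + b by omega, dist_comm _ y] at h2
    have h3 := dist_triangle4 y (f^[m] y) (f^[m - a + b] y) (f^[b - a] y)
    linarith
  have htb : TotallyBounded ((fun n => f^[n] y) '' {n | 1 ≤ n ∧ dist y (f^[n] y) ≤ 1}) := by
    refine (isCompact_closedBall y 1).totallyBounded.subset ?_
    rintro _ ⟨n, hn, rfl⟩
    rw [Metric.mem_closedBall, dist_comm]
    exact hn.2
  obtain ⟨T, hTS, hT, hcov⟩ := Metric.finite_approx_of_totallyBounded htb 1 one_pos
  have hT' : ∀ p ∈ T, ∃ m : ℕ, (1 ≤ m ∧ dist y (f^[m] y) ≤ 1) ∧ f^[m] y = p :=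
    fun p hp => hTS hp
  choose! idx hidx using hT'
  obtain ⟨M, hM⟩ := (hT.image idx).bddAbove
  -- Returns to the unit ball are within 1 of finitely many of them, whose times are bounded by M.
  have hdesc : ∀ n : ℕ, 1 ≤ n → dist y (f^[n] y) ≤ 1 → ∃ a, 1 ≤ a ∧ a ≤ M ∧
      dist (f^[a] y) (f^[n] y) ≤ 1 := by
    intro n hn hn1
    obtain ⟨p, hp, hd⟩ := mem_iUnion₂.1 (hcov ⟨n, ⟨hn, hn1⟩, rfl⟩)
    have h1 := hidx p hp
    refine ⟨idx p, h1.1.1, hM ⟨p, hp, rfl⟩, ?_⟩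
    have h2 : f^[idx p] y = p := h1.2
    rw [h2, dist_comm]
    exact (Metric.mem_ball.1 hd).le
  -- By `hiso`, subtracting such a time a from a return time N gives another return time. Steps of
  -- size between 1 and M cannot jump over the window [k, k + M].
  have hsynd : ∀ k N : ℕ, k ≤ N → dist y (f^[N] y) ≤ 1 →
      ∃ m, k ≤ m ∧ m ≤ k + M ∧ dist y (f^[m] y) ≤ 1 := by
    intro k N
    induction N using Nat.strong_induction_on with
    | _ N ih =>
      intro hkN hN
      by_cases hle : N ≤ k + M
      · exact ⟨N, hkN, hle, hN⟩
      obtain ⟨a, ha1, haM, had⟩ := hdesc N (by omega) hN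
      exact ih (N - a) (by omega) (by omega) ((hiso a N (by omega)).trans had)
  refine ⟨1 + ∑ j ∈ Finset.range (M + 1), dist y (f^[j] y), fun k => ?_⟩
  obtain ⟨N, hkN, hN⟩ := hrec 1 one_pos k
  obtain ⟨m, hkm, hmM, hm⟩ := hsynd k N hkN hN
  have h1 := hit k y (f^[m - k] y)
  rw [← Function.iterate_add_apply, show k + (m - k) = m by omega] at h1
  have h2 := Finset.single_le_sum (f := fun j => dist y (f^[j] y)) (fun _ _ => dist_nonneg)
    (Finset.mem_range.2 (show m - k < M + 1 by omega))
  have h3 := dist_triangle_right y (f^[k] y) (f^[m] y)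
  linarith

/-! ### Bounded orbits yield fixed points -/

/-- The points of `D`, as carrier of the Kobayashi distance. -/
structure KobayashiSpace {n : ℕ} (D : Set (Cn n)) where
  val : Cn n
  mem : val ∈ D

/-- The Kobayashi distance of an open convex set. -/
noncomputable abbrev kobayashiPseudoMetricSpace {n : ℕ} {D : Set (Cn n)} (hc : Convex ℝ D)
    (ho : IsOpen D) : PseudoMetricSpace (KobayashiSpace D) where
  dist z w := kobayashiDist D z.val w.val
  dist_self z := kobayashiDist_self z.mem
  dist_comm z w := kobayashiDist_comm hc ho z.mem w.mem
  dist_triangle z w y := kobayashiDist_triangle hc ho z.mem w.mem y.mem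

section
variable {n : ℕ} {D : Set (Cn n)} {z w y z₀ : Cn n} {f : Cn n → Cn n}

theorem properSpace_kobayashiSpace (hc : Convex ℝ D) (ho : IsOpen D)
    (hb : Bornology.IsBounded D) :
    @ProperSpace (KobayashiSpace D) (kobayashiPseudoMetricSpace hc ho) := by
  let _ := kobayashiPseudoMetricSpace hc ho
  refine ⟨fun x r => IsSeqCompact.isCompact fun u hu => ?_⟩
  obtain ⟨K, hKD, hK, hKm⟩ := exists_compact_of_kobayashiDist_le hc ho hb x.mem r
  have hu' : ∀ i, (u i).val ∈ K := fun i => hKm _ (u i).mem (by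
    rw [kobayashiDist_comm hc ho x.mem (u i).mem]
    exact hu i)
  obtain ⟨a, ha, φ, hφ, hlim⟩ := hK.tendsto_subseq hu'
  have ht : Tendsto (u ∘ φ) atTop (𝓝 (⟨a, hKD ha⟩ : KobayashiSpace D)) := by
    rw [tendsto_iff_dist_tendsto_zero]
    have := tendsto_kobayashiDist hc ho (hKD ha) (hKD ha) hlim tendsto_const_nhds
    rwa [kobayashiDist_self (hKD ha)] at this
  exact ⟨⟨a, hKD ha⟩, Metric.isClosed_closedBall.mem_of_tendsto ht
    (Eventually.of_forall fun i => hu (φ i)), φ, hφ, ht⟩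

theorem iterate_mem (hfm : MapsTo f D D) (hz : z ∈ D) (k : ℕ) : f^[k] z ∈ D :=
  hfm.iterate k hz

theorem exists_kobayashiDist_orbit_bound (hc : Convex ℝ D) (ho : IsOpen D)
    (hb : Bornology.IsBounded D) (hf : DifferentiableOn ℂ f D) (hfm : MapsTo f D D)
    (hz : z ∈ D) {s : ℕ → ℕ} (hs : StrictMono s)
    (h : Tendsto (fun i => f^[s i] z) atTop (𝓝 y)) (hy : y ∈ D) :
    ∃ C, ∀ k, kobayashiDist D y (f^[k] y) ≤ C := by
  let _ := kobayashiPseudoMetricSpace hc ho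
  have := properSpace_kobayashiSpace hc ho hb
  let F : KobayashiSpace D → KobayashiSpace D := fun p => ⟨f p.val, hfm p.mem⟩
  have hit : ∀ (k : ℕ) (p : KobayashiSpace D), (F^[k] p).val = f^[k] p.val := fun k p =>
    Function.Semiconj.iterate_right (f := KobayashiSpace.val) (ga := F) (gb := f)
      (fun _ => rfl) k p
  obtain ⟨C, hC⟩ := exists_orbit_bound (f := F) (x := ⟨z, hz⟩) (y := ⟨y, hy⟩)
    (fun a b => kobayashiDist_map_le hc ho hf hfm a.mem b.mem) hs (by
      rw [tendsto_iff_dist_tendsto_zero]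
      have := tendsto_kobayashiDist hc ho hy hy h tendsto_const_nhds
      rw [kobayashiDist_self hy] at this
      refine this.congr fun i => ?_
      change _ = kobayashiDist D (F^[s i] _).val y
      rw [hit])
  refine ⟨C, fun k => ?_⟩
  have := hC k
  change kobayashiDist D y (F^[k] _).val ≤ C at this
  rwa [hit] at this

theorem fixedPoint_of_tendsto {ι : Type*} {l : Filter ι} [l.NeBot] {x : ι → Cn n} {s : ι → ℝ}
    {p : Cn n} (hs : Tendsto s l (𝓝 0)) (hx : Tendsto x l (𝓝 p)) (hf : ContinuousAt f p)
    (h : ∀ i, (1 - s i) • f (x i) + s i • z₀ = x i) : f p = p := by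
  have h1 : Tendsto (fun i => (1 - s i) • f (x i) + s i • z₀) l
      (𝓝 ((1 - 0 : ℝ) • f p + (0 : ℝ) • z₀)) :=
    ((tendsto_const_nhds.sub hs).smul (hf.tendsto.comp hx)).add (hs.smul_const z₀)
  simp only [h, sub_zero, one_smul, zero_smul, add_zero] at h1
  exact tendsto_nhds_unique h1 hx

theorem tendsto_one_div_add_two : Tendsto (fun i : ℕ => 1 / ((i : ℝ) + 2)) atTop (𝓝 0) :=
  tendsto_const_nhds.div_atTop
    (tendsto_atTop_add_const_right _ _ tendsto_natCast_atTop_atTop)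

theorem one_div_add_two_mem (i : ℕ) : 0 < 1 / ((i : ℝ) + 2) ∧ 1 / ((i : ℝ) + 2) ≤ 1 := by
  refine ⟨by positivity, ?_⟩
  rw [div_le_one (by positivity)]
  linarith [(Nat.cast_nonneg i : (0 : ℝ) ≤ i)]

/-- The points eventually within C + 1 of the orbit (at matching times) form an f-invariant, convex,
relatively compact set containing z. It is preserved by the perturbations of f towards z, whose
fixed points therefore accumulate inside D, at a fixed point of f. -/
theorem exists_fixedPoint_of_orbit_bound (hc : Convex ℝ D) (ho : IsOpen D)
    (hb : Bornology.IsBounded D) (hf : DifferentiableOn ℂ f D) (hfm : MapsTo f D D)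
    (hz : z ∈ D) {C : ℝ} (hC : ∀ k, kobayashiDist D z (f^[k] z) ≤ C) : ∃ x ∈ D, f x = x := by
  set A : Set (Cn n) := {w | w ∈ D ∧ ∀ᶠ k in atTop, kobayashiDist D w (f^[k] z) < C + 1} with hA
  have hzA : z ∈ A := ⟨hz, Eventually.of_forall fun k => (hC k).trans_lt (by linarith)⟩
  have hit := iterate_mem hfm hz
  have hfA : MapsTo f A A := by
    intro w hw
    refine ⟨hfm hw.1, ?_⟩
    obtain ⟨N, hN⟩ := eventually_atTop.1 hw.2
    refine eventually_atTop.2 ⟨N + 1, fun k hk => ?_⟩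
    obtain ⟨k, rfl⟩ : ∃ j, k = j + 1 := ⟨k - 1, by omega⟩
    rw [Function.iterate_succ_apply']
    exact (kobayashiDist_map_le hc ho hf hfm hw.1 (hit k)).trans_lt (hN k (by omega))
  have hcA : ∀ w ∈ A, ∀ w' ∈ A, ∀ a b : ℝ, 0 ≤ a → 0 ≤ b → a + b = 1 → a • w + b • w' ∈ A := by
    intro w hw w' hw' a b ha hb' hab
    refine ⟨hc hw.1 hw'.1 ha hb' hab, ?_⟩
    filter_upwards [hw.2, hw'.2] with k h1 h2
    exact kobayashiDist_combo_lt hc ho hw.1 hw'.1 (hit k) h1 h2 ha hb' hab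
  obtain ⟨K, hKD, hK, hKm⟩ := exists_compact_of_kobayashiDist_le hc ho hb hz (C + (C + 1))
  have hAK : A ⊆ K := by
    intro w hw
    obtain ⟨k, hk⟩ := hw.2.exists
    refine hKm w hw.1 ?_
    have h1 := kobayashiDist_triangle hc ho hz (hit k) hw.1
    rw [kobayashiDist_comm hc ho (hit k) hw.1] at h1
    linarith [hC k]
  have hfix : ∀ i : ℕ, ∃ x ∈ K, (1 - 1 / ((i : ℝ) + 2)) • f x + (1 / ((i : ℝ) + 2)) • z = x := by
    intro i
    obtain ⟨h1, h2⟩ := one_div_add_two_mem i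
    exact exists_fixedPoint_perturbed hc ho hb hf hfm hz h1 h2 hK hKD hAK ⟨z, hzA⟩
      fun w hw => hcA _ (hfA hw) _ hzA _ _ (sub_nonneg.2 h2) h1.le (by ring)
  choose x hxK hx using hfix
  obtain ⟨p, hp, φ, hφ, hlim⟩ := hK.tendsto_subseq hxK
  exact ⟨p, hKD hp, fixedPoint_of_tendsto (tendsto_one_div_add_two.comp hφ.tendsto_atTop) hlim
    (hf.continuousOn.continuousAt (ho.mem_nhds (hKD hp))) fun i => hx (φ i)⟩

/-! ### Boundary accumulation and the horofunction -/

/-- The approximate fixed points of a fixed point free map accumulate at the boundary. -/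
theorem exists_tendsto_frontier (hc : Convex ℝ D) (ho : IsOpen D) (hb : Bornology.IsBounded D)
    (hf : DifferentiableOn ℂ f D) (hfm : MapsTo f D D) (hfix : ∀ z ∈ D, f z ≠ z) (hz₀ : z₀ ∈ D) :
    ∃ x ∈ frontier D, ∃ (u : ℕ → Cn n) (s : ℕ → ℝ), (∀ i, u i ∈ D) ∧ Tendsto u atTop (𝓝 x) ∧
      Tendsto s atTop (𝓝 0) ∧ (∀ i, 0 < s i ∧ s i ≤ 1) ∧
      ∀ i, (1 - s i) • f (u i) + s i • z₀ = u i := by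
  have hfix' : ∀ i : ℕ, ∃ x ∈ D, (1 - 1 / ((i : ℝ) + 2)) • f x + (1 / ((i : ℝ) + 2)) • z₀ = x := by
    intro i
    obtain ⟨h1, h2⟩ := one_div_add_two_mem i
    have hsub := homothety_subset hc ho hz₀ h1 h2
    obtain ⟨x, hx, h⟩ := exists_fixedPoint_perturbed hc ho hb hf hfm hz₀ h1 h2
      (isCompact_homothety hb _ z₀) hsub subset_rfl
      ⟨_, mem_image_of_mem _ (subset_closure hz₀)⟩
      fun w hw => mem_image_of_mem _ (subset_closure (hfm (hsub hw)))
    exact ⟨x, hsub hx, h⟩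
  choose u huD hu using hfix'
  obtain ⟨x, hx, φ, hφ, hlim⟩ := hb.isCompact_closure.tendsto_subseq
    fun i => subset_closure (huD i)
  have hs := tendsto_one_div_add_two.comp hφ.tendsto_atTop
  refine ⟨x, ?_, u ∘ φ, _, fun i => huD _, hlim, hs, fun i => one_div_add_two_mem (φ i),
    fun i => hu (φ i)⟩
  rw [ho.frontier_eq]
  exact ⟨hx, fun hxD => hfix x hxD (fixedPoint_of_tendsto hs hlim
    (hf.continuousOn.continuousAt (ho.mem_nhds hxD)) fun i => hu (φ i))⟩

/-- Every sequence in `D` has a subsequence along which the differences of Kobayashi distances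
converge. -/
theorem exists_subseq_tendsto_kobayashiDist_sub (hc : Convex ℝ D) (ho : IsOpen D) (hz₀ : z₀ ∈ D)
    {u : ℕ → Cn n} (hu : ∀ i, u i ∈ D) : ∃ φ : ℕ → ℕ, StrictMono φ ∧ ∀ z ∈ D, ∃ l : ℝ,
      Tendsto (fun i => kobayashiDist D z (u (φ i)) - kobayashiDist D z₀ (u (φ i)))
        atTop (𝓝 l) := by
  have : Nonempty D := ⟨⟨z₀, hz₀⟩⟩
  have hlip : ∀ z ∈ D, ∀ w ∈ D, ∀ i, |kobayashiDist D z (u i) - kobayashiDist D w (u i)| ≤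
      kobayashiDist D z w := by
    intro z hz w hw i
    have h1 := kobayashiDist_triangle hc ho hz hw (hu i)
    have h2 := kobayashiDist_triangle hc ho hw hz (hu i)
    rw [kobayashiDist_comm hc ho hw hz] at h2
    rw [abs_le]
    constructor <;> linarith
  obtain ⟨q, hq⟩ := TopologicalSpace.exists_dense_seq D
  -- Compactness of a countable product of intervals gives convergence on a dense sequence; the
  -- uniform Lipschitz bound `hlip` extends it to D.
  obtain ⟨l, -, φ, hφ, hlim⟩ := (isCompact_univ_pi fun j : ℕ =>
    isCompact_Icc (a := -kobayashiDist D (q j) z₀) (b := kobayashiDist D (q j) z₀)).tendsto_subseq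
    (x := fun i j => kobayashiDist D (q j) (u i) - kobayashiDist D z₀ (u i))
    fun i j _ => abs_le.1 (hlip _ (q j).2 _ hz₀ i)
  rw [tendsto_pi_nhds] at hlim
  refine ⟨φ, hφ, fun z hz => cauchySeq_tendsto_of_complete (Metric.cauchySeq_iff'.2 ?_)⟩
  intro ε hε
  have hnear : ∀ᶠ w in 𝓝 z, kobayashiDist D z w < ε / 3 :=
    (tendsto_kobayashiDist_self ho hz).eventually (gt_mem_nhds (by linarith))
  have hnear' : ∀ᶠ w : D in 𝓝 ⟨z, hz⟩, kobayashiDist D z w < ε / 3 :=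
    (continuous_subtype_val.tendsto (⟨z, hz⟩ : D)).eventually hnear
  obtain ⟨_, ⟨j, rfl⟩, hqj⟩ := hq.inter_nhds_nonempty hnear'
  obtain ⟨N, hN⟩ := Metric.cauchySeq_iff'.1 (hlim j).cauchySeq (ε / 3) (by linarith)
  refine ⟨N, fun m hm => ?_⟩
  have h1 := hN m hm
  have h2 := abs_le.1 ((hlip z hz _ (q j).2 (φ m)).trans (le_of_lt hqj))
  have h3 := abs_le.1 ((hlip z hz _ (q j).2 (φ N)).trans (le_of_lt hqj))
  simp only [Function.comp, Real.dist_eq, abs_lt] at h1 ⊢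
  constructor <;> linarith [h1.1, h1.2, h2.1, h2.2, h3.1, h3.2]

/-- The map does not increase the horofunction given by its approximate fixed points. -/
theorem horofunction_map_le (hc : Convex ℝ D) (ho : IsOpen D)
    (hf : DifferentiableOn ℂ f D) (hfm : MapsTo f D D) (hz₀ : z₀ ∈ D) {u : ℕ → Cn n}
    {s : ℕ → ℝ} (hu : ∀ i, u i ∈ D) (hs : Tendsto s atTop (𝓝 0)) (hs1 : ∀ i, 0 < s i ∧ s i ≤ 1)
    (hfix : ∀ i, (1 - s i) • f (u i) + s i • z₀ = u i) {H : Cn n → ℝ}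
    (hH : ∀ z ∈ D, Tendsto (fun i => kobayashiDist D z (u i) - kobayashiDist D z₀ (u i))
      atTop (𝓝 (H z))) (hz : z ∈ D) : H (f z) ≤ H z := by
  have hmem : ∀ i, ∀ w ∈ D, (1 - s i) • f w + s i • z₀ ∈ D := fun i w hw =>
    hc (hfm hw) hz₀ (sub_nonneg.2 (hs1 i).2) (hs1 i).1.le (by ring)
  have hlim : Tendsto (fun i => (1 - s i) • f z + s i • z₀) atTop (𝓝 (f z)) := by
    have := ((tendsto_const_nhds (x := (1 : ℝ))).sub hs).smul_const (f z) |>.add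
      (hs.smul_const z₀)
    simpa using this
  have hlim' := (tendsto_kobayashiDist_self ho (hfm hz)).comp hlim
  refine le_of_tendsto_of_tendsto' (hH _ (hfm hz)) (by simpa using (hH z hz).add hlim')
    fun i => ?_
  -- The i-th perturbed map fixes u i and is nonexpansive; its value at z differs from f z by a
  -- k_D-distance tending to 0.
  have h1 := kobayashiDist_triangle hc ho (hfm hz) (hmem i z hz) (hu i)
  have hd : DifferentiableOn ℂ (fun w => (1 - s i) • f w + s i • z₀) D :=
    (hf.const_smul (1 - s i)).add (differentiableOn_const _)
  have h2 := kobayashiDist_map_le hc ho hd (hmem i) hz (hu i)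
  rw [hfix i] at h2
  linarith

/-- Horofunctions centred at boundary points are unbounded below. -/
theorem exists_horofunction_le (hc : Convex ℝ D) (ho : IsOpen D) (hb : Bornology.IsBounded D)
    (hz₀ : z₀ ∈ D) {x : Cn n} (hx : x ∈ frontier D) {u : ℕ → Cn n} (hu : ∀ i, u i ∈ D)
    (hux : Tendsto u atTop (𝓝 x)) {H : Cn n → ℝ}
    (hH : ∀ z ∈ D, Tendsto (fun i => kobayashiDist D z (u i) - kobayashiDist D z₀ (u i))
      atTop (𝓝 (H z))) (c : ℝ) : ∃ p ∈ D, H p ≤ c := by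
  have hxD : x ∉ D := by rw [ho.frontier_eq] at hx; exact hx.2
  set T : ℝ := max (1 - c) 0 with hT
  have hT0 : 0 ≤ T := le_max_right _ _
  obtain ⟨K, hKD, hK, hKm⟩ := exists_compact_of_kobayashiDist_le hc ho hb hz₀ T
  have hfar : ∀ᶠ i in atTop, T < kobayashiDist D z₀ (u i) := by
    filter_upwards [hux.eventually_mem (hK.isClosed.isOpen_compl.mem_nhds fun h => hxD (hKD h))]
      with i hi
    by_contra hn
    exact hi (hKm _ (hu i) (not_lt.1 hn))
  -- p is the point at parameter T on an almost geodesic disc from z₀ to u i. The excess length 1 of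
  -- that disc explains the 1 in T, so that 1 - T ≤ c.
  have hp : ∀ i, ∃ p, T < kobayashiDist D z₀ (u i) → p ∈ K ∧
      kobayashiDist D p (u i) ≤ kobayashiDist D z₀ (u i) + 1 - T := by
    intro i
    by_cases hi : T < kobayashiDist D z₀ (u i)
    · obtain ⟨φ, hφ, hm, h0, h1⟩ := HasDisc.of_kobayashiDist_lt hc ho hz₀ (hu i)
        (show kobayashiDist D z₀ (u i) < kobayashiDist D z₀ (u i) + 1 by linarith)
      have d1 := HasDisc.of_tanh hφ hm 0 T
      have d2 := HasDisc.of_tanh hφ hm T (kobayashiDist D z₀ (u i) + 1)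
      rw [Real.tanh_zero, Complex.ofReal_zero, h0, zero_sub, abs_neg, abs_of_nonneg hT0] at d1
      rw [h1, abs_of_neg (by linarith)] at d2
      have d2' := d2.kobayashiDist_le (by linarith)
      exact ⟨_, fun _ => ⟨hKm _ d1.right_mem (d1.kobayashiDist_le hT0), by linarith⟩⟩
    · exact ⟨z₀, fun h => absurd h hi⟩
  choose p hp using hp
  obtain ⟨a, haK, φ, hφ, hlim⟩ := hK.tendsto_subseq' (x := p)
    (hfar.mono fun i hi => (hp i hi).1).frequently
  have ha := hKD haK
  refine ⟨a, ha, ?_⟩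
  have h1 := (hH a ha).comp hφ.tendsto_atTop
  have h2 := ((tendsto_kobayashiDist_self ho ha).comp hlim).add_const (1 - T)
  have h3 : H a ≤ 0 + (1 - T) := by
    refine le_of_tendsto_of_tendsto h1 h2 ?_
    filter_upwards [hφ.tendsto_atTop.eventually hfar] with i hi
    obtain ⟨h3, h4⟩ := hp _ hi
    have h5 := kobayashiDist_triangle hc ho ha (hKD h3) (hu (φ i))
    simp only [Function.comp]
    linarith
  linarith [le_max_left (1 - c) 0]

/-! ### Complex faces and limits of iterates -/

/-- A holomorphic map into the closure of `D` takes all its values in the complex face of any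
of them. -/
theorem mem_complexFace_of_mapsTo_closure (hc : Convex ℝ D) (ho : IsOpen D) {h : Cn n → Cn n}
    (hh : DifferentiableOn ℂ h D) (hm : MapsTo h D (closure D)) (hz : z ∈ D) (hw : w ∈ D) :
    h w ∈ complexFace D (h z) := by
  refine ⟨hm hw, fun L hL => ?_⟩
  set L' := LinearMap.toContinuousLinearMap L with hL'
  have hre : ∀ y ∈ D, 0 ≤ (L (h z) - L (h y)).re := by
    intro y hy
    have hcl : closure D ⊆ {y | (L' y).re ≤ (L' (h z)).re} :=
      closure_minimal (fun y hy => (hL y hy).le)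
        (isClosed_le (Complex.continuous_re.comp L'.continuous) continuous_const)
    have : (L (h y)).re ≤ (L (h z)).re := hcl (hm hy)
    rw [Complex.sub_re]
    linarith
  have hge : ∀ y ∈ D, 1 ≤ ‖1 + (L (h z) - L (h y))‖ := by
    intro y hy
    refine le_trans ?_ (Complex.re_le_norm _)
    rw [Complex.add_re, Complex.one_re]
    linarith [hre y hy]
  have hne : ∀ y ∈ D, 1 + (L (h z) - L (h y)) ≠ 0 := fun y hy h0 => by
    have := hge y hy
    rw [h0, norm_zero] at this
    linarith
  -- The denominator has real part at least 1, so this function has modulus at most 1, attained at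
  -- z; by the maximum principle it is constant.
  have hd : DifferentiableOn ℂ (fun y => (1 + (L (h z) - L (h y)))⁻¹) D := by
    refine DifferentiableOn.inv ?_ hne
    exact ((L'.differentiable.comp_differentiableOn hh).const_sub _).const_add _
  have hmax : IsMaxOn (norm ∘ fun y => (1 + (L (h z) - L (h y)))⁻¹) D z := by
    intro y hy
    simp only [mem_ofPred_eq, Function.comp, sub_self, add_zero, inv_one, norm_one, norm_inv]
    exact inv_le_one_of_one_le₀ (hge y hy)
  have := Complex.eqOn_of_isPreconnected_of_isMaxOn_norm hc.isPreconnected ho hd hz hmax hw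
  simp only [Function.const_apply, sub_self, add_zero, inv_one, inv_eq_one] at this
  linear_combination -this

theorem complexFaces_mono {F F' : Set (Cn n)} (h : F ⊆ F') : complexFaces D F ⊆ complexFaces D F' :=
  biUnion_subset_biUnion_left h

/-- Limits of iterates of a fixed point free map take values in the boundary. -/
theorem mem_frontier_of_tendsto_iterate (hc : Convex ℝ D) (ho : IsOpen D)
    (hb : Bornology.IsBounded D) (hf : DifferentiableOn ℂ f D) (hfm : MapsTo f D D)
    (hfix : ∀ z ∈ D, f z ≠ z) (hz : z ∈ D) {s : ℕ → ℕ} (hs : StrictMono s)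
    (h : Tendsto (fun i => f^[s i] z) atTop (𝓝 y)) : y ∈ frontier D := by
  rw [ho.frontier_eq]
  refine ⟨mem_closure_of_tendsto h (Eventually.of_forall fun i => iterate_mem hfm hz _),
    fun hy => ?_⟩
  obtain ⟨C, hC⟩ := exists_kobayashiDist_orbit_bound hc ho hb hf hfm hz hs h hy
  obtain ⟨x, hx, hfx⟩ := exists_fixedPoint_of_orbit_bound hc ho hb hf hfm hy hC
  exact hfix x hx hfx

end

/-! ### The theorem: horospheres as sublevel sets of one horofunction -/

theorem mainTheorem9 (n : ℕ) (D : Set (Cn n)) (hD_ne : D.Nonempty) (hD_open : IsOpen D)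
    (hD_convex : Convex ℝ D) (hD_bdd : Bornology.IsBounded D)
    (f : Cn n → Cn n) (hf_holo : DifferentiableOn ℂ f D) (hf_maps : MapsTo f D D)
    (hf_fix : ∀ z ∈ D, f z ≠ z) :
    ∃ x ∈ frontier D, ∃ u : ℕ → Cn n, IsHorosphereSequence D x u ∧
      ∀ z₀ ∈ D,
        targetSet D f ⊆
            (⋂ z ∈ D, complexFaces D (closure (sequenceHorosphere D z 1 u) ∩ frontier D)) ∧
          (⋂ z ∈ D, complexFaces D (closure (sequenceHorosphere D z 1 u) ∩ frontier D)) =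
            ⋂ (R : ℝ) (_ : 0 < R),
              complexFaces D (closure (sequenceHorosphere D z₀ R u) ∩ frontier D) := by
  obtain ⟨z₁, hz₁⟩ := hD_ne
  obtain ⟨x, hx, v, s, hv, hvx, hs, hs1, hvfix⟩ :=
    exists_tendsto_frontier hD_convex hD_open hD_bdd hf_holo hf_maps hf_fix hz₁
  obtain ⟨φ, hφ, hlim⟩ := exists_subseq_tendsto_kobayashiDist_sub hD_convex hD_open hz₁ hv
  choose! H hH using hlim
  have hux : Tendsto (fun i => v (φ i)) atTop (𝓝 x) := hvx.comp hφ.tendsto_atTop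
  have hH' : ∀ z₀ ∈ D, ∀ z ∈ D, Tendsto (fun i => kobayashiDist D z (v (φ i)) -
      kobayashiDist D z₀ (v (φ i))) atTop (𝓝 (H z - H z₀)) := fun z₀ hz₀ z hz =>
    ((hH z hz).sub (hH z₀ hz₀)).congr fun i => by ring
  have hG : ∀ z₀ ∈ D, ∀ (R : ℝ) (z : Cn n), z ∈ sequenceHorosphere D z₀ R (fun i => v (φ i)) ↔
      z ∈ D ∧ H z - H z₀ < 1 / 2 * Real.log R := by
    intro z₀ hz₀ R z
    constructor
    · rintro ⟨hz, l, hl, hlt⟩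
      exact ⟨hz, tendsto_nhds_unique hl (hH' z₀ hz₀ z hz) ▸ hlt⟩
    · rintro ⟨hz, hlt⟩
      exact ⟨hz, _, hH' z₀ hz₀ z hz, hlt⟩
  have hlow : ∀ c, ∃ p ∈ D, H p ≤ c := exists_horofunction_le hD_convex hD_open hD_bdd hz₁ hx
    (fun i => hv (φ i)) hux hH
  have hdecr : ∀ z ∈ D, ∀ k : ℕ, H (f^[k] z) ≤ H z := by
    intro z hz k
    induction k with
    | zero => rfl
    | succ k ih =>
      rw [Function.iterate_succ_apply']
      exact (horofunction_map_le hD_convex hD_open hf_holo hf_maps hz₁ (fun i => hv (φ i))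
        (hs.comp hφ.tendsto_atTop) (fun i => hs1 (φ i)) (fun i => hvfix (φ i)) hH
        (iterate_mem hf_maps hz k)).trans ih
  refine ⟨x, hx, fun i => v (φ i), ⟨hx, fun i => hv (φ i), hux,
    fun z₀ hz₀ z hz => ⟨_, hH' z₀ hz₀ z hz⟩⟩, fun z₀ hz₀ => ⟨?_, subset_antisymm ?_ ?_⟩⟩
  · rintro y ⟨h, t, hh, ht, hlim, w, hw, rfl⟩
    refine mem_iInter₂.2 fun z hz => ?_
    -- The drop by 1 keeps the whole orbit of p strictly below the level H z.
    obtain ⟨p, hp, hpz⟩ := hlow (H z - 1)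
    have hfr : ∀ w ∈ D, h w ∈ frontier D := fun w hw =>
      mem_frontier_of_tendsto_iterate hD_convex hD_open hD_bdd hf_holo hf_maps hf_fix hw ht
        (hlim.tendsto_at hw)
    refine mem_iUnion₂.2 ⟨h p, ⟨mem_closure_of_tendsto (hlim.tendsto_at hp)
      (Eventually.of_forall fun i => (hG z hz 1 _).2 ⟨iterate_mem hf_maps hp _, ?_⟩), hfr p hp⟩,
      mem_complexFace_of_mapsTo_closure hD_convex hD_open hh
        (fun w hw => frontier_subset_closure (hfr w hw)) hp hw⟩
    rw [Real.log_one]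
    linarith [hdecr p hp (t i)]
  · intro y hy
    refine mem_iInter₂.2 fun R _ => ?_
    -- A pole p this low has its radius-1 horosphere inside the one with pole z₀ and radius R.
    obtain ⟨p, hp, hpR⟩ := hlow (H z₀ + 1 / 2 * Real.log R)
    refine complexFaces_mono (inter_subset_inter_left _ (closure_mono fun z hz => ?_))
      (mem_iInter₂.1 hy p hp)
    obtain ⟨hzD, hz⟩ := (hG p hp 1 z).1 hz
    rw [Real.log_one] at hz
    exact (hG z₀ hz₀ R z).2 ⟨hzD, by linarith⟩
  · intro y hy
    refine mem_iInter₂.2 fun p hp => ?_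
    refine complexFaces_mono (inter_subset_inter_left _ (closure_mono fun z hz => ?_))
      -- This radius makes the level H z₀ + ½ log R equal to H p.
      (mem_iInter₂.1 hy (Real.exp (2 * (H p - H z₀))) (Real.exp_pos _))
    obtain ⟨hzD, hz⟩ := (hG z₀ hz₀ _ z).1 hz
    rw [Real.log_exp] at hz
    refine (hG p hp 1 z).2 ⟨hzD, ?_⟩
    rw [Real.log_one]
    linarith
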